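/- Let $d\ge 1$ and let $g\in L^2(\mathbb{R}^d)$, $g\neq 0$. For $z=(x,\xi)\in\mathbb{R}^{2d}$ let $\pi(z)g(t)=e^{2\pi i\xi\cdot t}g(t-x)$ and $V_gg(z)=\int_{\mathbb{R}^d}g(t)\overline{g(t-x)}e^{-2\pi i\xi\cdot t}\,dt=\langle g,\pi(z)g\rangle$. Assume that either $g\in M^\infty_{v_s}(\mathbb{R}^d)$ for some $s>2d$, i.e. there is a constant $C$ with $|V_gg(z)|\le C(1+|z|)^{-s}$ for all $z\in\mathbb{R}^{2d}$, or $g\in M^1(\mathbb{R}^d)$, i.e. $\int_{\mathbb{R}^{2d}}|\langle g,\pi(z)g\rangle|\,dz<\infty$. A lattice in $\mathbb{R}^{2d}$ is a set $\Lambda=A\mathbb{Z}^{2d}$ with $A\in GL(2d,\mathbb{R})$; its volume is $\mathrm{vol}(\Lambda)=|\det A|$, and the space of lattices carries the quotient topology induced by the map $A\mapsto A\mathbb{Z}^{2d}$ on $GL(2d,\mathbb{R})$. The Gabor system $\mathcal{G}(g,\Lambda)=\{\pi(\lambda)g:\lambda\in\Lambda\}$ is a frame if there are constants $A_0,B_0>0$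 such that $A_0\|f\|_2^2\le\sum_{\lambda\in\Lambda}|\langle f,\pi(\lambda)g\rangle|^2\le B_0\|f\|_2^2$ for all $f\in L^2(\mathbb{R}^d)$. Let $\mathcal{F}_{\mathrm{full}}(g)$ be the set of all lattices $\Lambda$ such that $\mathcal{G}(g,\Lambda)$ is a frame, and let $\mathcal{F}(g)$ be the set of all $(\alpha,\beta)$ with $\alpha,\beta>0$ such that $\mathcal{G}(g,\alpha\mathbb{Z}^d\times\beta\mathbb{Z}^d)$ is a frame. Then: 1. $\mathcal{F}_{\mathrm{full}}(g)$ is an open subset of $\{\Lambda:\mathrm{vol}(\Lambda)<1\}$ and contains a neighbourhood of $0$, i.e. there is a neighbourhood $V$ of the zero matrix in $\mathbb{R}^{2d\times 2d}$ such that $A\mathbb{Z}^{2d}\in\mathcal{F}_{\mathrm{full}}(g)$ for every invertible $A\in V$. 2. $\mathcal{F}(g)$ is an open subset of $\{(\alpha,\beta):\alpha,\beta>0,\ \alpha\beta<1\}$ and contains a neighbourhood of $(0,0)$ in $\{(\alpha,\beta):\alpha,\beta>0\}$, i.e. there is a neighbourhood $U$ of $(0,0)$ in $\mathbb{R}^2$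 such that every $(\alpha,\beta)\in U$ with $\alpha,\beta>0$ lies in $\mathcal{F}(g)$. -/

import Mathlib

open MeasureTheory Topology
open scoped ENNReal

noncomputable section

namespace Gabor

/-- The time domain `ℝ^d`. -/
abbrev Time (d : ℕ) : Type := EuclideanSpace ℝ (Fin d)

/-- The time-frequency plane `ℝ^{2d}` with its Euclidean norm; the left summand indexes the
time coordinates `x`, the right summand the frequency coordinates `ξ` of `z = (x, ξ)`. -/
abbrev Phase (d : ℕ) : Type := EuclideanSpace ℝ (Fin d ⊕ Fin d)

/-- The time component `x` of `z = (x, ξ)`. -/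
def timePart {d : ℕ} (z : Phase d) : Time d := WithLp.toLp 2 (fun i => z (Sum.inl i))

/-- The frequency component `ξ` of `z = (x, ξ)`. -/
def freqPart {d : ℕ} (z : Phase d) : Time d := WithLp.toLp 2 (fun i => z (Sum.inr i))

/-- The Hilbert space `L²(ℝ^d)` of complex-valued functions. -/
abbrev L2 (d : ℕ) : Type := Lp ℂ 2 (volume : Measure (Time d))

/-- The time-frequency shift of a function, `t ↦ e^{2πi ξ·t} f(t - x)`. -/
def tfShiftFun {d : ℕ} (z : Phase d) (f : Time d → ℂ) : Time d → ℂ := fun t =>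
  Complex.exp (2 * Real.pi * Complex.I * (inner ℝ (freqPart z) t : ℝ)) * f (t - timePart z)

theorem memLp_tfShiftFun {d : ℕ} (z : Phase d) {f : Time d → ℂ}
    (hf : MemLp f 2 (volume : Measure (Time d))) :
    MemLp (tfShiftFun z f) 2 (volume : Measure (Time d)) := by
  have h1 : MemLp (fun t => f (t - timePart z)) 2 (volume : Measure (Time d)) :=
    hf.comp_measurePreserving (measurePreserving_sub_right volume (timePart z))
  have hc : Continuous fun t : Time d =>
      Complex.exp (2 * Real.pi * Complex.I * (inner ℝ (freqPart z) t : ℝ)) := by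
    fun_prop
  refine h1.of_le (hc.aestronglyMeasurable.mul h1.1) (Filter.Eventually.of_forall fun t => ?_)
  have h2 : ‖Complex.exp (2 * Real.pi * Complex.I * (inner ℝ (freqPart z) t : ℝ))‖ = 1 := by
    rw [Complex.norm_exp]
    simp
  simp only [tfShiftFun, norm_mul, h2, one_mul]
  exact le_rfl

/-- The time-frequency shift `π(z)` on `L²(ℝ^d)`. -/
def tfShift {d : ℕ} (z : Phase d) (f : L2 d) : L2 d :=
  (memLp_tfShiftFun z (Lp.memLp f)).toLp (tfShiftFun z f)

/-- The short-time Fourier transform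
`V_g f(x, ξ) = ∫ f(t) conj(g(t - x)) e^{-2πi ξ·t} dt`. -/
def stft {d : ℕ} (g f : L2 d) (z : Phase d) : ℂ :=
  ∫ t : Time d, f t * (starRingEnd ℂ) (g (t - timePart z)) *
    Complex.exp (-(2 * Real.pi * Complex.I * (inner ℝ (freqPart z) t : ℝ)))

/-- `g ∈ M^∞_{v_s}(ℝ^d)`: the bound `|V_g g(z)| ≤ C (1 + |z|)^{-s}` holds on `ℝ^{2d}`. -/
def MemMInfty {d : ℕ} (s : ℝ) (g : L2 d) : Prop :=
  ∃ C : ℝ, ∀ z : Phase d, ‖stft g g z‖ ≤ C * (1 + ‖z‖) ^ (-s)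

/-- `g ∈ M¹(ℝ^d)`: the function `z ↦ ⟨g, π(z) g⟩` is integrable on `ℝ^{2d}`.
(Mathlib's `inner ℂ u v` is conjugate-linear in `u`.) -/
def MemMOne {d : ℕ} (g : L2 d) : Prop :=
  Integrable (fun z : Phase d => inner ℂ (tfShift z g) g) volume

/-- A family `v` in a complex Hilbert space is a frame if there are `A, B > 0` with
`A ‖f‖² ≤ ∑ |⟨f, v_i⟩|² ≤ B ‖f‖²` for all `f`. -/
def IsFrame {ι H : Type*} [NormedAddCommGroup H] [InnerProductSpace ℂ H] (v : ι → H) : Prop :=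
  ∃ A B : ℝ, 0 < A ∧ 0 < B ∧ ∀ f : H,
    Summable (fun i => ‖inner ℂ (v i) f‖ ^ 2) ∧
    A * ‖f‖ ^ 2 ≤ ∑' i, ‖inner ℂ (v i) f‖ ^ 2 ∧
    ∑' i, ‖inner ℂ (v i) f‖ ^ 2 ≤ B * ‖f‖ ^ 2

/-- The Gabor system `{π(l) g : l ∈ S}` is a frame for `L²(ℝ^d)`. -/
def IsGaborFrame {d : ℕ} (g : L2 d) (S : Set (Phase d)) : Prop :=
  IsFrame (fun l : S => tfShift (l : Phase d) g)

/-- The point set `A ℤ^{2d}`. -/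
def latticeSet {d : ℕ} (A : Matrix (Fin d ⊕ Fin d) (Fin d ⊕ Fin d) ℝ) : Set (Phase d) :=
  Set.range fun k : Fin d ⊕ Fin d → ℤ => WithLp.toLp 2 (A.mulVec fun i => (k i : ℝ))

/-- The lattices in `ℝ^{2d}`: the subsets of the form `A ℤ^{2d}` with `A` invertible. -/
def Lattice (d : ℕ) : Type :=
  {S : Set (Phase d) // ∃ A : GL (Fin d ⊕ Fin d) ℝ, latticeSet (A : Matrix _ _ ℝ) = S}

/-- The lattice `A ℤ^{2d}` generated by an invertible matrix `A`. -/
def Lattice.ofGL {d : ℕ} (A : GL (Fin d ⊕ Fin d) ℝ) : Lattice d :=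
  ⟨latticeSet (A : Matrix _ _ ℝ), A, rfl⟩

/-- The usual topology on the space of lattices `GL(2d, ℝ) / GL(2d, ℤ)`: the quotient topology
for the map `A ↦ A ℤ^{2d}`. -/
instance Lattice.instTopologicalSpace {d : ℕ} : TopologicalSpace (Lattice d) :=
  TopologicalSpace.coinduced Lattice.ofGL inferInstance

/-- The volume `|det A|` of the lattice `A ℤ^{2d}`, for any choice of the generator `A`
(see `Lattice.vol_ofGL` for the independence of the choice). -/
def Lattice.vol {d : ℕ} (L : Lattice d) : ℝ :=
  |(L.2.choose : Matrix (Fin d ⊕ Fin d) (Fin d ⊕ Fin d) ℝ).det|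

theorem abs_det_le_of_latticeSet_subset {d : ℕ}
    {A B : Matrix (Fin d ⊕ Fin d) (Fin d ⊕ Fin d) ℝ} (hA : A.det ≠ 0)
    (h : latticeSet A ⊆ latticeSet B) : |B.det| ≤ |A.det| := by
  have h1 : ∀ j, ∃ k : Fin d ⊕ Fin d → ℤ,
      (B.mulVec fun i => (k i : ℝ)) = fun i => A i j := by
    intro j
    obtain ⟨k, hk⟩ := h ⟨Pi.single j 1, rfl⟩
    refine ⟨k, ?_⟩
    have h2 := WithLp.toLp_injective 2 hk
    rw [h2]
    have h3 : (fun i => ((Pi.single j 1 : Fin d ⊕ Fin d → ℤ) i : ℝ)) = Pi.single j 1 := by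
      ext i
      by_cases hij : i = j
      · subst hij; simp
      · simp [hij]
    rw [h3, Matrix.mulVec_single_one]
    rfl
  choose k hk using h1
  let K : Matrix (Fin d ⊕ Fin d) (Fin d ⊕ Fin d) ℤ := fun i j => k j i
  have hAB : A = B * K.map (Int.castRingHom ℝ) := by
    ext i j
    exact (congrFun (hk j) i).symm
  have hdet : A.det = B.det * (K.det : ℝ) := by
    rw [hAB, Matrix.det_mul]
    congr 1
    exact (RingHom.map_det (Int.castRingHom ℝ) K).symm
  have hK : K.det ≠ 0 := by
    intro h0
    apply hA
    rw [hdet, h0]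
    simp
  have hK1 : (1 : ℝ) ≤ |(K.det : ℝ)| := by
    exact_mod_cast Int.one_le_abs hK
  rw [hdet, abs_mul]
  exact le_mul_of_one_le_right (abs_nonneg _) hK1

theorem Lattice.vol_ofGL {d : ℕ} (A : GL (Fin d ⊕ Fin d) ℝ) :
    (Lattice.ofGL A).vol = |(A : Matrix (Fin d ⊕ Fin d) (Fin d ⊕ Fin d) ℝ).det| := by
  have h := (Lattice.ofGL A).2.choose_spec
  have hne : ∀ C : GL (Fin d ⊕ Fin d) ℝ,
      (C : Matrix (Fin d ⊕ Fin d) (Fin d ⊕ Fin d) ℝ).det ≠ 0 := fun C =>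
    ((Matrix.isUnit_iff_isUnit_det _).1 C.isUnit).ne_zero
  exact le_antisymm (abs_det_le_of_latticeSet_subset (hne _) h.ge)
    (abs_det_le_of_latticeSet_subset (hne _) h.le)

/-- The full frame set of `g`: all lattices over which `g` generates a Gabor frame. -/
def fullFrameSet {d : ℕ} (g : L2 d) : Set (Lattice d) :=
  {L | IsGaborFrame g L.1}

/-- The rectangular point set `α ℤ^d × β ℤ^d`. -/
def rectSet (d : ℕ) (α β : ℝ) : Set (Phase d) :=
  {z | (∀ i, ∃ k : ℤ, z (Sum.inl i) = α * k) ∧ (∀ i, ∃ l : ℤ, z (Sum.inr i) = β * l)}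

/-- The reduced frame set of `g`: all pairs `(α, β)` of positive numbers such that `g` generates
a Gabor frame over `α ℤ^d × β ℤ^d`. -/
def reducedFrameSet {d : ℕ} (g : L2 d) : Set (ℝ × ℝ) :=
  {p | 0 < p.1 ∧ 0 < p.2 ∧ IsGaborFrame g (rectSet d p.1 p.2)}

end Gabor

end

/-! Both decay hypotheses make the ambiguity function `z ↦ |⟨π(z)g, g⟩|` integrable. Only three
further facts about time-frequency shifts are used: they form a projective isometric representation,
they are strongly continuous, and they satisfy Moyal's orthogonality relations. Phases of the
representation drop out of all frame sums.

Integrability improves itself: the reproducing formula dominates the ambiguity function by a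
convolution, so its local suprema are integrable too (`exists_majorant`). Sums over a lattice
`Bℤ^{2d}` with small cell are then at most a constant over `|det B|`, and Schur's test turns such
sums into Bessel bounds.

Neighbourhood of 0 (`exists_fine_frame`): by Moyal, the frame sums of the windows `π(Bv)g`, averaged
over `v` in the unit cube, equal `‖f‖²‖g‖²/|det B|`. For a fine lattice, replacing `π(Bv)g` by `g`
costs a small Bessel bound, which leaves a positive lower bound.

Volume at most one (`abs_det_le_one`): for the dual window `γ = S⁻¹g`, the same averaging gives
`Re⟨g, γ⟩ = |det A|`, while `|⟨g, γ⟩|² ≤ ∑ |⟨π(λ)g, γ⟩|² = ⟨γ, g⟩`.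

Openness (`eventually_lower_bound`): small changes of `A` move distant lattice points far, so the
lower bound is localized. Write `A = qB` with `B` fine. The orbit over `B` is a frame, uniformly
near the given `B`, so every `f` is nearly a finite sum `∑ c_m π(Bm)g` with `∑ |c_m|² ≤ ‖f‖²/a₀`.
The lower bound over `qB` becomes a statement about the matrix of `S - a` in this system, whose
off-diagonal decay is uniform in `B`. Averaging over boxes (`le_re_inner_of_local`) reduces it to
boxes of fixed side, covariance moves each box to the origin (`local_lower_of_box`), and there
finitely many entries depend continuously on `B` (`eventually_local_lower`).

Openness upgrades the volume bound to a strict one: a slight dilation of a frame lattice still gives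
a frame, so its volume is still at most one. -/

noncomputable section

namespace Gabor

/-! ### Bessel families, Schur's test and the frame operator. -/

section Frames

variable {ι H : Type*} [NormedAddCommGroup H] [InnerProductSpace ℂ H]

/-- `C` is a Bessel bound of the family `u`. -/
def IsBessel (u : ι → H) (C : ℝ) : Prop :=
  ∀ (f : H) (s : Finset ι), ∑ i ∈ s, ‖inner ℂ (u i) f‖ ^ 2 ≤ C * ‖f‖ ^ 2

theorem IsBessel.summable {u : ι → H} {C : ℝ} (h : IsBessel u C) (f : H) :
    Summable fun i => ‖inner ℂ (u i) f‖ ^ 2 :=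
  summable_of_sum_le (fun _ => by positivity) (h f)

theorem IsBessel.tsum_le {u : ι → H} {C : ℝ} (h : IsBessel u C) (f : H) :
    ∑' i, ‖inner ℂ (u i) f‖ ^ 2 ≤ C * ‖f‖ ^ 2 :=
  (h.summable f).tsum_le_of_sum_le (h f)

theorem IsBessel.mono {u : ι → H} {C D : ℝ} (h : IsBessel u C) (hCD : C ≤ D) : IsBessel u D :=
  fun f s => (h f s).trans (by gcongr)

theorem IsBessel.comp {κ : Type*} {u : ι → H} {C : ℝ} (h : IsBessel u C) {e : κ → ι}
    (he : Function.Injective e) : IsBessel (u ∘ e) C := by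
  intro f s
  have := h f (s.map ⟨e, he⟩)
  simpa using this

/-- Schur's test for a Hermitian-dominated quadratic form on a finite index set. -/
theorem sum_sum_mul_mul_le {s : Finset ι} {a : ι → ι → ℝ} {x : ι → ℝ} {C : ℝ}
    (ha : ∀ i j, 0 ≤ a i j) (hsymm : ∀ i j, a i j = a j i)
    (hC : ∀ i ∈ s, ∑ j ∈ s, a i j ≤ C) :
    ∑ i ∈ s, ∑ j ∈ s, x i * x j * a i j ≤ C * ∑ i ∈ s, x i ^ 2 := by
  have h1 : ∑ i ∈ s, ∑ j ∈ s, x i * x j * a i j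
      ≤ ∑ i ∈ s, ∑ j ∈ s, (x i ^ 2 * a i j / 2 + x j ^ 2 * a i j / 2) := by
    refine Finset.sum_le_sum fun i _ => Finset.sum_le_sum fun j _ => ?_
    nlinarith [mul_nonneg (sq_nonneg (x i - x j)) (ha i j)]
  have h2 : ∑ i ∈ s, ∑ j ∈ s, x j ^ 2 * a i j / 2 = ∑ i ∈ s, ∑ j ∈ s, x i ^ 2 * a i j / 2 := by
    rw [Finset.sum_comm]
    refine Finset.sum_congr rfl fun i _ => Finset.sum_congr rfl fun j _ => ?_
    rw [hsymm j i]
  refine h1.trans ?_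
  simp only [Finset.sum_add_distrib]
  rw [h2, ← two_mul, Finset.mul_sum, Finset.mul_sum]
  refine Finset.sum_le_sum fun i hi => ?_
  rw [← Finset.sum_div, ← Finset.mul_sum]
  nlinarith [mul_le_mul_of_nonneg_left (hC i hi) (sq_nonneg (x i))]

/-- Schur's test for the Gram matrix, which expresses the squared norm of the sum. -/
theorem norm_sum_smul_sq_le {s : Finset ι} {u : ι → H} {C : ℝ} (c : ι → ℂ)
    (hC : ∀ i ∈ s, ∑ j ∈ s, ‖inner ℂ (u i) (u j)‖ ≤ C) :
    ‖∑ i ∈ s, c i • u i‖ ^ 2 ≤ C * ∑ i ∈ s, ‖c i‖ ^ 2 := by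
  have h1 : ‖∑ i ∈ s, c i • u i‖ ^ 2
      ≤ ∑ i ∈ s, ∑ j ∈ s, ‖c i‖ * ‖c j‖ * ‖inner ℂ (u i) (u j)‖ := by
    calc ‖∑ i ∈ s, c i • u i‖ ^ 2
        = ‖inner ℂ (∑ i ∈ s, c i • u i) (∑ j ∈ s, c j • u j)‖ := by
          rw [inner_self_eq_norm_sq_to_K]; simp
      _ ≤ _ := by
          rw [sum_inner]
          refine (norm_sum_le _ _).trans (Finset.sum_le_sum fun i _ => ?_)
          rw [inner_sum]
          refine (norm_sum_le _ _).trans (Finset.sum_le_sum fun j _ => ?_)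
          rw [inner_smul_left, inner_smul_right]
          simp [mul_assoc]
  exact h1.trans (sum_sum_mul_mul_le (fun _ _ => norm_nonneg _)
    (fun i j => norm_inner_symm _ _) hC)

/-- Duality: with `x = ∑ ⟨u i, f⟩ u i` and `X = ∑ |⟨u i, f⟩|²`, one has `X = ⟨x, f⟩ ≤ ‖x‖‖f‖` and
`‖x‖² ≤ C X`, so that `X² ≤ C‖f‖² X`, and `X` cancels. -/
theorem isBessel_of_gram {u : ι → H} {C : ℝ} (hC0 : 0 ≤ C)
    (hC : ∀ s : Finset ι, ∀ i ∈ s, ∑ j ∈ s, ‖inner ℂ (u i) (u j)‖ ≤ C) : IsBessel u C := by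
  intro f s
  set X := ∑ i ∈ s, ‖inner ℂ (u i) f‖ ^ 2 with hX
  have hX0 : 0 ≤ X := by positivity
  set x := ∑ i ∈ s, inner ℂ (u i) f • u i with hx
  have h1 : X = ‖inner ℂ x f‖ := by
    have : inner ℂ x f = (X : ℂ) := by
      rw [hx, sum_inner, hX]
      push_cast
      refine Finset.sum_congr rfl fun i _ => ?_
      rw [inner_smul_left, RCLike.conj_mul]
      rfl
    rw [this]; simp [abs_of_nonneg hX0]
  have h2 : ‖x‖ ^ 2 ≤ C * X := norm_sum_smul_sq_le _ (hC s)
  have h3 : X ≤ ‖x‖ * ‖f‖ := h1.le.trans (norm_inner_le_norm _ _)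
  rcases hX0.eq_or_lt with h0 | h0
  · rw [← h0]; positivity
  · have h4 : X * X ≤ C * ‖f‖ ^ 2 * X := by calc
      X * X ≤ (‖x‖ * ‖f‖) * (‖x‖ * ‖f‖) := mul_self_le_mul_self hX0 h3
      _ = ‖x‖ ^ 2 * ‖f‖ ^ 2 := by ring
      _ ≤ C * X * ‖f‖ ^ 2 := by gcongr
      _ = C * ‖f‖ ^ 2 * X := by ring
    exact le_of_mul_le_mul_right h4 h0

/-- The analysis operator `f ↦ (⟨u i, f⟩)_i` of a Bessel family. -/
def analysisOp (u : ι → H) {C : ℝ} (h : IsBessel u C) : H →L[ℂ] lp (fun _ : ι => ℂ) 2 :=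
  LinearMap.mkContinuous
    { toFun := fun f => ⟨fun i => inner ℂ (u i) f, memℓp_gen (by simpa using h.summable f)⟩
      map_add' := fun f f' => by ext i; exact inner_add_right _ _ _
      map_smul' := fun c f => by ext i; exact inner_smul_right _ _ _ }
    -- A Bessel bound may be negative when `H` is trivial; the maximum keeps the square root
    -- multiplicative.
    (Real.sqrt (max C 0)) (fun f => by
      rw [← Real.sqrt_sq (norm_nonneg f), ← Real.sqrt_mul (le_max_right _ _)]
      refine Real.le_sqrt_of_sq_le ?_
      have h1 := lp.norm_rpow_eq_tsum (p := 2) (by norm_num)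
        (⟨fun i => inner ℂ (u i) f, memℓp_gen (by simpa using h.summable f)⟩ :
          lp (fun _ : ι => ℂ) 2)
      simp only [ENNReal.toReal_ofNat, Real.rpow_ofNat] at h1
      refine h1.le.trans ((h.tsum_le f).trans ?_)
      gcongr
      exact le_max_left _ _)

@[simp] theorem analysisOp_apply {u : ι → H} {C : ℝ} (h : IsBessel u C) (f : H) (i : ι) :
    analysisOp u h f i = inner ℂ (u i) f := rfl

variable [CompleteSpace H]

/-- The frame operator `f ↦ ∑ ⟨u i, f⟩ u i` of a Bessel family. -/
def frameOp (u : ι → H) {C : ℝ} (h : IsBessel u C) : H →L[ℂ] H :=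
  (analysisOp u h).adjoint ∘L analysisOp u h

theorem hasSum_inner_frameOp {u : ι → H} {C : ℝ} (h : IsBessel u C) (f f' : H) :
    HasSum (fun i => inner ℂ f (u i) * inner ℂ (u i) f') (inner ℂ f (frameOp u h f')) := by
  have h1 := lp.hasSum_inner (𝕜 := ℂ) (analysisOp u h f) (analysisOp u h f')
  rw [frameOp, ContinuousLinearMap.comp_apply, ContinuousLinearMap.adjoint_inner_right]
  refine h1.congr_fun fun i => ?_
  rw [analysisOp_apply, analysisOp_apply, RCLike.inner_apply, inner_conj_symm, mul_comm]

theorem hasSum_norm_sq_frameOp {u : ι → H} {C : ℝ} (h : IsBessel u C) (f : H) :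
    HasSum (fun i => ‖inner ℂ (u i) f‖ ^ 2) (RCLike.re (inner ℂ f (frameOp u h f))) := by
  have h1 := (hasSum_inner_frameOp h f f).mapL Complex.reCLM
  refine h1.congr_fun fun i => ?_
  rw [← inner_conj_symm f, RCLike.conj_mul, Complex.reCLM_apply]
  norm_cast

theorem inner_frameOp_comm {u : ι → H} {C : ℝ} (h : IsBessel u C) (f f' : H) :
    inner ℂ (frameOp u h f) f' = inner ℂ f (frameOp u h f') := by
  simp [frameOp, ContinuousLinearMap.adjoint_inner_right, ContinuousLinearMap.adjoint_inner_left]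

/-- The lower frame bound is coercivity of the frame operator, so Lax–Milgram applies. -/
theorem isUnit_frameOp {u : ι → H} {C a : ℝ} (h : IsBessel u C) (ha : 0 < a)
    (hlow : ∀ f, a * ‖f‖ ^ 2 ≤ ∑' i, ‖inner ℂ (u i) f‖ ^ 2) : IsUnit (frameOp u h) := by
  refine ContinuousLinearMap.isUnit_of_forall_le_norm_inner_map _ (c := ⟨a, ha.le⟩) ha fun f => ?_
  have h1 := hlow f
  rw [(hasSum_norm_sq_frameOp h f).tsum_eq] at h1
  rw [inner_frameOp_comm, mul_comm]
  exact h1.trans (RCLike.re_le_norm _)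

theorem hasSum_frameOp {u : ι → H} {C : ℝ} (h : IsBessel u C) (f : H) :
    HasSum (fun i => inner ℂ (u i) f • u i) (frameOp u h f) := by
  classical
  have h1 := (lp.hasSum_single (p := 2) (by norm_num) (analysisOp u h f)).mapL
    (analysisOp u h).adjoint
  rw [frameOp, ContinuousLinearMap.comp_apply]
  convert h1 using 2 with i
  refine ext_inner_right ℂ fun f' => ?_
  rw [ContinuousLinearMap.adjoint_inner_left, lp.inner_single_left, inner_smul_left]
  simp [mul_comm]

/-- A frame with lower bound `a` has approximate finite expansions with coefficients
controlled by `a⁻¹`. -/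
theorem exists_finset_expansion {u : ι → H} {C a : ℝ} (h : IsBessel u C) (ha : 0 < a)
    (hlow : ∀ f, a * ‖f‖ ^ 2 ≤ ∑' i, ‖inner ℂ (u i) f‖ ^ 2) (f : H) {η : ℝ} (hη : 0 < η) :
    ∃ (s : Finset ι) (c : ι → ℂ), ‖∑ i ∈ s, c i • u i - f‖ < η ∧
      ∑ i ∈ s, ‖c i‖ ^ 2 ≤ ‖f‖ ^ 2 / a := by
  -- With `f = S f'` the coefficients are `⟨u i, f'⟩`; their square sum is at most `⟨f', S f'⟩ ≤
  -- ‖f'‖‖f‖`, and `a‖f'‖ ≤ ‖f‖`.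
  obtain ⟨f', rfl⟩ : ∃ f', frameOp u h f' = f :=
    ((ContinuousLinearMap.isUnit_iff_bijective).1 (isUnit_frameOp h ha hlow)).2 f
  have h1 := (Metric.tendsto_nhds.1 (hasSum_frameOp h f') η hη).exists
  obtain ⟨s, hs⟩ := h1
  refine ⟨s, fun i => inner ℂ (u i) f', by rwa [dist_eq_norm] at hs, ?_⟩
  have h2 := hasSum_norm_sq_frameOp h f'
  have h3 : a * ‖f'‖ ^ 2 ≤ RCLike.re (inner ℂ f' (frameOp u h f')) := by
    rw [← h2.tsum_eq]; exact hlow f'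
  have h4 : RCLike.re (inner ℂ f' (frameOp u h f')) ≤ ‖f'‖ * ‖frameOp u h f'‖ :=
    (RCLike.re_le_norm _).trans (norm_inner_le_norm _ _)
  refine (sum_le_hasSum s (fun _ _ => by positivity) h2).trans (h4.trans ?_)
  have h5 : a * ‖f'‖ ≤ ‖frameOp u h f'‖ := by
    rcases (norm_nonneg f').eq_or_lt with h0 | h0
    · rw [← h0]; simp
    · nlinarith
  rw [le_div_iff₀ ha]
  nlinarith [norm_nonneg (frameOp u h f')]

end Frames
end Gabor

end

/-! ### Lattice points, and integrals unfolded over a fundamental cell. -/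

noncomputable section

namespace Gabor

section Lattices

variable {J : Type*}

/-- An integral vector, viewed as a real vector. -/
def intPt (j : J → ℤ) : J → ℝ := fun i => (j i : ℝ)

@[simp] theorem intPt_zero : intPt (0 : J → ℤ) = 0 := by ext; simp [intPt]

theorem intPt_add (j k : J → ℤ) : intPt (j + k) = intPt j + intPt k := by ext; simp [intPt]

theorem intPt_sub (j k : J → ℤ) : intPt (j - k) = intPt j - intPt k := by ext; simp [intPt]

/-- The half-open unit cube. -/
def unitCube (J : Type*) : Set (J → ℝ) := Set.pi Set.univ fun _ => Set.Ico 0 1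

variable [Fintype J]

/-- The point `B x` of Euclidean space. -/
def latPt (B : Matrix J J ℝ) (x : J → ℝ) : EuclideanSpace ℝ J := WithLp.toLp 2 (B.mulVec x)


@[simp] theorem latPt_zero (B : Matrix J J ℝ) : latPt B 0 = 0 := by simp [latPt]

theorem latPt_add (B : Matrix J J ℝ) (x y : J → ℝ) : latPt B (x + y) = latPt B x + latPt B y := by
  simp [latPt, Matrix.mulVec_add]

theorem latPt_sub (B : Matrix J J ℝ) (x y : J → ℝ) : latPt B (x - y) = latPt B x - latPt B y := by
  simp [latPt, Matrix.mulVec_sub]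

theorem latPt_smul (B : Matrix J J ℝ) (c : ℝ) (x : J → ℝ) : latPt (c • B) x = latPt B (c • x) := by
  simp [latPt, Matrix.mulVec_smul, Matrix.smul_mulVec]

theorem continuous_latPt (B : Matrix J J ℝ) : Continuous (latPt B) := by
  unfold latPt
  exact (PiLp.continuous_toLp 2 _).comp (Continuous.matrix_mulVec continuous_const continuous_id)

theorem continuous_latPt_left (x : J → ℝ) : Continuous fun B : Matrix J J ℝ => latPt B x := by
  unfold latPt
  exact (PiLp.continuous_toLp 2 _).comp (Continuous.matrix_mulVec continuous_id continuous_const)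

theorem measurableSet_unitCube : MeasurableSet (unitCube J) :=
  MeasurableSet.univ_pi fun _ => measurableSet_Ico

theorem volume_unitCube : volume (unitCube J) = 1 := by
  simp [unitCube, volume_pi, Measure.pi_pi]

variable [DecidableEq J]

theorem lintegral_pi_eq_tsum (F : (J → ℝ) → ℝ≥0∞) :
    ∫⁻ x, F x = ∑' j : J → ℤ, ∫⁻ v in unitCube J, F (intPt j + v) := by
  have : VAddInvariantMeasure (Submodule.span ℤ (Set.range (Pi.basisFun ℝ J))) (J → ℝ) volume :=
    inferInstanceAs <| VAddInvariantMeasure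
      (Submodule.span ℤ (Set.range (Pi.basisFun ℝ J))).toAddSubgroup (J → ℝ) volume
  have h := (ZSpan.isAddFundamentalDomain (Pi.basisFun ℝ J) volume).lintegral_eq_tsum'' F
  rw [ZSpan.fundamentalDomain_pi_basisFun] at h
  rw [h]
  let e := ((Pi.basisFun ℝ J).restrictScalars ℤ).equivFun.symm.toEquiv
  rw [← e.tsum_eq]
  refine tsum_congr fun j => ?_
  have he : ((e j : Submodule.span ℤ (Set.range (Pi.basisFun ℝ J))) : J → ℝ) = intPt j := by
    simp only [e, LinearEquiv.coe_toEquiv, Module.Basis.equivFun_symm_apply]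
    ext i
    simp [intPt, Finset.sum_apply, Pi.single_apply]
  have h2 : ∀ v : J → ℝ, e j +ᵥ v = intPt j + v := fun v => by
    rw [← he]; rfl
  simp only [h2]
  rfl

/-- Change of variables `z = Bx`, followed by tiling of `x`-space by integer translates of the unit
cube. -/
theorem lintegral_eq_det_mul_lintegral_tsum {B : Matrix J J ℝ} (hB : B.det ≠ 0)
    {F : EuclideanSpace ℝ J → ℝ≥0∞} (hF : Measurable F) :
    ∫⁻ z, F z = ENNReal.ofReal |B.det| *
      ∫⁻ v in unitCube J, ∑' j : J → ℤ, F (latPt B (intPt j + v)) := by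
  have hm : Measurable (latPt B) := (continuous_latPt B).measurable
  rw [lintegral_tsum (fun j => by fun_prop),
    ← lintegral_pi_eq_tsum (fun x => F (latPt B x)),
    ← (PiLp.volume_preserving_toLp J).lintegral_comp hF]
  have hF' : Measurable fun x : J → ℝ => F (WithLp.toLp 2 x) :=
    hF.comp (PiLp.continuous_toLp 2 _).measurable
  have h1 := Real.map_matrix_volume_pi_eq_smul_volume_pi hB
  have h2 : ∫⁻ x, F (latPt B x) = ∫⁻ x, F (WithLp.toLp 2 x) ∂(Measure.map (Matrix.toLin' B) volume) := by
    rw [lintegral_map hF' (by fun_prop)]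
    rfl
  rw [h2, h1, lintegral_smul_measure, smul_eq_mul, ← mul_assoc, ← ENNReal.ofReal_mul (abs_nonneg _),
    ← abs_mul, mul_inv_cancel₀ hB]
  simp

/-- The comparison of sums with integrals behind every estimate over a lattice: a majorant on each
cell is enough, since the unit cube has volume one. -/
theorem det_mul_tsum_le {B : Matrix J J ℝ} (hB : B.det ≠ 0)
    {F : EuclideanSpace ℝ J → ℝ≥0∞} (hF : Measurable F) {w : (J → ℤ) → ℝ≥0∞}
    (hw : ∀ j, ∀ v ∈ unitCube J, w j ≤ F (latPt B (intPt j + v))) :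
    ENNReal.ofReal |B.det| * ∑' j, w j ≤ ∫⁻ z, F z := by
  rw [lintegral_eq_det_mul_lintegral_tsum hB hF]
  gcongr
  calc ∑' j, w j = ∫⁻ _ in unitCube J, ∑' j, w j := by simp [volume_unitCube]
    _ ≤ _ := setLIntegral_mono' measurableSet_unitCube fun v hv =>
        ENNReal.tsum_le_tsum fun j => hw j v hv

end Lattices

end Gabor

end

/-! ### Projective representations, ambiguity functions and the reproducing formula. -/

noncomputable section

namespace Gabor

/-- A strongly continuous projective unitary representation of the additive group `V`. -/
structure ProjRep (V H : Type*) [NormedAddCommGroup V] [NormedAddCommGroup H]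
    [InnerProductSpace ℂ H] where
  /-- The operators of the representation. -/
  op : V → H →ₗᵢ[ℂ] H
  op_zero : ∀ f, op 0 f = f
  exists_op_add : ∀ z w, ∃ c : ℂ, ‖c‖ = 1 ∧ ∀ f, op (z + w) f = c • op z (op w f)
  continuous_op : ∀ f, Continuous fun z => op z f

namespace ProjRep

section General

variable {V H : Type*} [NormedAddCommGroup V] [NormedAddCommGroup H] [InnerProductSpace ℂ H]
  (π : ProjRep V H)

/-- The operators are only assumed to be isometries; this supplies their surjectivity. -/
theorem exists_op_neg (z : V) : ∃ c : ℂ, ‖c‖ = 1 ∧ ∀ f, f = c • π.op z (π.op (-z) f) := by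
  obtain ⟨c, hc, h⟩ := π.exists_op_add z (-z)
  exact ⟨c, hc, fun f => by rw [← h, add_neg_cancel, π.op_zero]⟩

theorem norm_inner_op_op (z w : V) (f h : H) :
    ‖inner ℂ (π.op z f) (π.op w h)‖ = ‖inner ℂ f (π.op (w - z) h)‖ := by
  obtain ⟨c, hc, h1⟩ := π.exists_op_add z (w - z)
  rw [show π.op w h = π.op (z + (w - z)) h by simp, h1, inner_smul_right,
    LinearIsometry.inner_map_map]
  simp [hc]

theorem norm_inner_op_left (z : V) (f h : H) :
    ‖inner ℂ (π.op z f) h‖ = ‖inner ℂ f (π.op (-z) h)‖ := by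
  obtain ⟨c, hc, h1⟩ := π.exists_op_neg z
  conv_lhs => rw [h1 h]
  rw [inner_smul_right, LinearIsometry.inner_map_map]
  simp [hc]

theorem norm_inner_op_add_right (z w : V) (f g : H) :
    ‖inner ℂ (π.op (z + w) g) f‖ = ‖inner ℂ (π.op z (π.op w g)) f‖ := by
  obtain ⟨c, hc, h⟩ := π.exists_op_add z w
  rw [h, inner_smul_left]
  simp [hc]

/-- The modulus of the ambiguity function of `g`. -/
def amb (g : H) (z : V) : ℝ := ‖inner ℂ (π.op z g) g‖

theorem amb_nonneg (g : H) (z : V) : 0 ≤ π.amb g z := norm_nonneg _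

theorem amb_neg (g : H) (z : V) : π.amb g (-z) = π.amb g z := by
  rw [amb, norm_inner_op_left, neg_neg, norm_inner_symm, amb]

theorem norm_inner_op_op_self (z w : V) (g : H) :
    ‖inner ℂ (π.op z g) (π.op w g)‖ = π.amb g (w - z) := by
  rw [norm_inner_op_op, norm_inner_symm, amb]

theorem continuous_amb (g : H) : Continuous (π.amb g) :=
  ((π.continuous_op g).inner continuous_const).norm

end General

section Moyal

variable {V H : Type*} [NormedAddCommGroup V] [MeasureSpace V] [BorelSpace V]
  [NormedAddCommGroup H] [InnerProductSpace ℂ H] (π : ProjRep V H)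

/-- The orthogonality relations, in norm form. -/
def Moyal : Prop := ∀ f g, ∫⁻ z, ‖inner ℂ (π.op z g) f‖ₑ ^ 2 = ‖f‖ₑ ^ 2 * ‖g‖ₑ ^ 2

variable {π}

theorem Moyal.memLp (hπ : π.Moyal) (f g : H) :
    MemLp (fun z => inner ℂ (π.op z g) f) 2 (volume : Measure V) := by
  refine ⟨((π.continuous_op g).inner continuous_const).aestronglyMeasurable, ?_⟩
  rw [eLpNorm_lt_top_iff_lintegral_rpow_enorm_lt_top (by norm_num) (by norm_num)]
  simp only [ENNReal.toReal_ofNat, ENNReal.rpow_ofNat]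
  rw [hπ]
  exact ENNReal.mul_lt_top (by simp) (by simp)

/-- The reproducing formula, as an inequality. -/
theorem Moyal.enorm_inner_mul_le (hπ : π.Moyal) (φ f f' : H) :
    ‖φ‖ₑ ^ 2 * ‖inner ℂ f f'‖ₑ ≤
      ∫⁻ z, ‖inner ℂ (π.op z φ) f‖ₑ * ‖inner ℂ (π.op z φ) f'‖ₑ := by
  rcases eq_or_ne φ 0 with rfl | hφ
  · simp
  have hφ' : ‖φ‖ ≠ 0 := norm_ne_zero_iff.2 hφ
  have hφe : ‖φ‖ₑ ≠ 0 := enorm_ne_zero.2 hφ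
  -- Scaling by `1/‖φ‖` makes `f ↦ ⟨π(·)φ, a f⟩` isometric into `L²`. A linear isometry preserves
  -- inner products, so the norm form of Moyal's relations suffices.
  let a : ℂ := ((‖φ‖⁻¹ : ℝ) : ℂ)
  have ha : ‖a‖ₑ = ‖φ‖ₑ⁻¹ := by
    simp only [a]
    rw [← ofReal_norm, Complex.norm_real, norm_inv, norm_norm, ENNReal.ofReal_inv_of_pos
      (norm_pos_iff.2 hφ), ofReal_norm]
  let W : H →ₗ[ℂ] Lp ℂ 2 (volume : Measure V) :=
    { toFun := fun f => (hπ.memLp (a • f) φ).toLp _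
      map_add' := fun f f' => by
        rw [← MemLp.toLp_add]
        congr 1
        ext z
        simp
      map_smul' := fun c f => by
        rw [RingHom.id_apply, ← MemLp.toLp_const_smul]
        congr 1
        ext z
        simp only [Pi.smul_apply, inner_smul_right, smul_eq_mul]
        ring }
  have hW : ∀ f, ‖W f‖ = ‖f‖ := by
    intro f
    have h1 : ‖W f‖ₑ ^ 2 = ‖f‖ₑ ^ 2 := by
      have h2 : ‖W f‖ₑ = eLpNorm (fun z => inner ℂ (π.op z φ) (a • f)) 2 volume :=
        Lp.enorm_toLp (hπ.memLp (a • f) φ)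
      rw [h2, eLpNorm_eq_lintegral_rpow_enorm_toReal (by norm_num) (by norm_num)]
      simp only [ENNReal.toReal_ofNat, ENNReal.rpow_ofNat, one_div]
      rw [← ENNReal.rpow_natCast, ← ENNReal.rpow_mul, hπ, enorm_smul, ha]
      simp only [Nat.cast_ofNat, isUnit_iff_ne_zero, ne_eq, OfNat.ofNat_ne_zero,
        not_false_eq_true, IsUnit.inv_mul_cancel, ENNReal.rpow_one]
      rw [mul_pow, mul_right_comm, ← mul_pow, ENNReal.inv_mul_cancel hφe (by simp), one_pow,
        one_mul]
    have h3 := congrArg ENNReal.toReal h1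
    simp only [ENNReal.toReal_pow, toReal_enorm] at h3
    exact (pow_left_inj₀ (norm_nonneg _) (norm_nonneg _) two_ne_zero).1 h3
  let Wi : H →ₗᵢ[ℂ] Lp ℂ 2 (volume : Measure V) := ⟨W, hW⟩
  have h1 : inner ℂ (Wi f) (Wi f') = inner ℂ f f' := Wi.inner_map_map f f'
  have h2 : inner ℂ (Wi f) (Wi f') = ∫ z, inner ℂ (inner ℂ (π.op z φ) (a • f) : ℂ)
      (inner ℂ (π.op z φ) (a • f') : ℂ) := by
    rw [L2.inner_def]
    refine integral_congr_ae ?_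
    filter_upwards [(hπ.memLp (a • f) φ).coeFn_toLp, (hπ.memLp (a • f') φ).coeFn_toLp] with z h h'
    change inner ℂ (((hπ.memLp (a • f) φ).toLp _ : Lp ℂ 2 (volume : Measure V)) z) 
      (((hπ.memLp (a • f') φ).toLp _ : Lp ℂ 2 (volume : Measure V)) z) = _
    rw [h, h']
  have h3 : ‖inner ℂ f f'‖ₑ ≤ ∫⁻ z, ‖φ‖ₑ⁻¹ ^ 2 *
      (‖inner ℂ (π.op z φ) f‖ₑ * ‖inner ℂ (π.op z φ) f'‖ₑ) := by
    rw [← h1, h2]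
    refine (enorm_integral_le_lintegral_enorm _).trans (lintegral_mono fun z => le_of_eq ?_)
    simp only [inner_smul_right, RCLike.inner_apply, enorm_mul, map_mul, RCLike.enorm_conj, ha]
    ring
  rw [lintegral_const_mul' _ _ (by simp [hφe])] at h3
  calc ‖φ‖ₑ ^ 2 * ‖inner ℂ f f'‖ₑ
      ≤ ‖φ‖ₑ ^ 2 * (‖φ‖ₑ⁻¹ ^ 2 *
        ∫⁻ z, ‖inner ℂ (π.op z φ) f‖ₑ * ‖inner ℂ (π.op z φ) f'‖ₑ) := by gcongr
    _ = _ := by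
      rw [← mul_assoc, ← mul_pow, ENNReal.mul_inv_cancel hφe (by simp), one_pow, one_mul]

end Moyal

/-! ### Integrable local suprema of the ambiguity function. -/

section Majorant

variable {V H : Type*} [NormedAddCommGroup V] [NormedSpace ℝ V] [FiniteDimensional ℝ V]
  [MeasureSpace V] [BorelSpace V] [(volume : Measure V).IsAddHaarMeasure]
  [NormedAddCommGroup H] [InnerProductSpace ℂ H] [CompleteSpace H] {π : ProjRep V H}

/-- Averaging `g` over a small ball gives a window correlated with `g` whose
cross-ambiguity function with `g` has integrable local suprema. -/
theorem exists_window {g : H} (hg : g ≠ 0) (π : ProjRep V H) : ∃ (φ : H) (r : ℝ), φ ≠ 0 ∧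
    ∀ z, ‖inner ℂ φ (π.op z g)‖ₑ ≤
      ∫⁻ u in Metric.closedBall (0 : V) r, ‖π.amb g (z - u)‖ₑ := by
  have hgn : 0 < ‖g‖ := norm_pos_iff.2 hg
  have hc : Filter.Tendsto (fun u => RCLike.re (inner ℂ (π.op 0 g) (π.op u g)))
      (𝓝 (0 : V)) (𝓝 (‖g‖ ^ 2)) := by
    have h1 : Continuous fun u => RCLike.re (inner ℂ (π.op 0 g) (π.op u g)) :=
      RCLike.continuous_re.comp (continuous_const.inner (π.continuous_op g))
    convert h1.tendsto 0 using 2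
    rw [inner_self_eq_norm_sq, LinearIsometry.norm_map]
  -- On this ball `Re⟨g, π(u)g⟩ > ‖g‖²/2`, so the average of `π(u)g` has positive correlation with
  -- `g` and cannot vanish.
  have hev := hc.eventually_const_lt (show ‖g‖ ^ 2 / 2 < ‖g‖ ^ 2 by nlinarith [pow_pos hgn 2])
  obtain ⟨r, hr, hball⟩ := Metric.nhds_basis_closedBall.eventually_iff.1 hev
  set D := Metric.closedBall (0 : V) r
  have hD : IsCompact D := isCompact_closedBall 0 r
  have hint : IntegrableOn (fun u => π.op u g) D volume :=
    (π.continuous_op g).continuousOn.integrableOn_compact hD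
  refine ⟨∫ u in D, π.op u g, r, ?_, fun z => ?_⟩
  · intro h0
    have h1 : inner ℂ (π.op 0 g) (∫ u in D, π.op u g) =
        ∫ u in D, inner ℂ (π.op 0 g) (π.op u g) := (integral_inner hint _).symm
    have h2 : RCLike.re (∫ u in D, inner ℂ (π.op 0 g) (π.op u g)) =
        ∫ u in D, RCLike.re (inner ℂ (π.op 0 g) (π.op u g)) :=
      (integral_re (hint.const_inner _)).symm
    have h3 : ∫ u in D, ‖g‖ ^ 2 / 2 ≤ ∫ u in D, RCLike.re (inner ℂ (π.op 0 g) (π.op u g)) :=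
      setIntegral_mono_on (integrableOn_const hD.measure_lt_top.ne) (hint.const_inner _).re
        hD.measurableSet fun u hu => (hball hu).le
    rw [← h2, ← h1, h0] at h3
    have h4 : 0 < (volume : Measure V).real D := 
      ENNReal.toReal_pos (Metric.measure_closedBall_pos _ _ hr).ne' hD.measure_lt_top.ne
    simp only [setIntegral_const, smul_eq_mul, inner_zero_right, map_zero] at h3
    nlinarith [pow_pos hgn 2, mul_pos h4 (pow_pos hgn 2)]
  · have h1 : inner ℂ (π.op z g) (∫ u in D, π.op u g) =
        ∫ u in D, inner ℂ (π.op z g) (π.op u g) := (integral_inner hint _).symm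
    rw [← ofReal_norm, norm_inner_symm, ofReal_norm, h1]
    refine (enorm_integral_le_lintegral_enorm _).trans (lintegral_mono fun u => le_of_eq ?_)
    rw [← ofReal_norm, norm_inner_symm, norm_inner_op_op_self, ← ofReal_norm,
      Real.norm_of_nonneg (π.amb_nonneg _ _)]

/-- The ambiguity function of a window in the Feichtinger algebra has integrable local suprema. -/
theorem exists_majorant (hπ : π.Moyal) {g : H} (hg : g ≠ 0)
    (hint : ∫⁻ z, ‖π.amb g z‖ₑ ≠ ∞) (R : ℝ) :
    ∃ M : V → ℝ≥0∞, Measurable M ∧ ∫⁻ z, M z ≠ ∞ ∧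
      ∀ z v, ‖v‖ ≤ R → ‖π.amb g (z + v)‖ₑ ≤ M z := by
  obtain ⟨φ, r, hφ, hwin⟩ := exists_window hg π
  set K : V → ℝ≥0∞ := fun z => ‖π.amb g z‖ₑ with hK
  have hKm : Measurable K := (π.continuous_amb g).enorm.measurable
  -- Local averages of the ambiguity function. Unlike the function itself, they absorb a bounded
  -- shift of the argument by enlarging the ball, and by Tonelli they stay integrable.
  set N : ℝ → V → ℝ≥0∞ := fun s z => ∫⁻ u in Metric.closedBall (0 : V) s, K (z - u) with hN
  have hNm : ∀ s, Measurable (N s) := fun s =>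
    Measurable.lintegral_prod_right' (f := fun p : V × V => K (p.1 - p.2))
      (hKm.comp (measurable_fst.sub measurable_snd))
  have hNint : ∀ s, ∫⁻ z, N s z ≠ ∞ := by
    intro s
    have hm : Measurable (Function.uncurry fun z u : V => K (z - u)) :=
      hKm.comp (measurable_fst.sub measurable_snd)
    rw [lintegral_lintegral_swap hm.aemeasurable]
    simp only [lintegral_sub_right_eq_self K]
    rw [lintegral_const]
    exact ENNReal.mul_ne_top hint
      (by simpa using (isCompact_closedBall (0 : V) s).measure_lt_top.ne)
  set Φ : V → ℝ≥0∞ := fun z => ‖inner ℂ φ (π.op z g)‖ₑ with hΦ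
  have hΦm : Measurable Φ := (continuous_const.inner (π.continuous_op g)).enorm.measurable
  have hΦint : ∫⁻ z, Φ (-z) ≠ ∞ := by
    rw [lintegral_neg_eq_self Φ]
    exact ((lintegral_mono hwin).trans_lt (hNint r).lt_top).ne
  have hNshift : ∀ z v, ‖v‖ ≤ R → Φ (z + v) ≤ N (r + R) z := by
    intro z v hv
    refine (hwin _).trans ?_
    have h1 : ∀ u, K (z + v - u) = (fun u => K (z - u)) (u - v) := fun u => by
      simp only; congr 1; abel
    have h2 : ∫⁻ u in Metric.closedBall (0 : V) r, K (z + v - u) =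
        ∫⁻ u in (fun u => u - v) ⁻¹' (Metric.closedBall (-v) r), (fun u => K (z - u)) (u - v) := by
      simp only [h1]
      congr 2
      ext u
      simp [dist_eq_norm]
    rw [h2, (measurePreserving_sub_right volume v).setLIntegral_comp_preimage
      measurableSet_closedBall (f := fun u => K (z - u)) (hKm.comp (measurable_const_sub z))]
    refine lintegral_mono_set (Metric.closedBall_subset_closedBall' ?_)
    simpa [dist_eq_norm] using hv
  have hφe : ‖φ‖ₑ ≠ 0 := enorm_ne_zero.2 hφ
  -- The reproducing formula with window `φ` bounds the ambiguity function by a convolution of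
  -- cross-ambiguity functions. The factor containing `v` is replaced by `N (r + R)`, leaving a
  -- convolution of two integrable functions independent of `v`.
  refine ⟨fun z => (‖φ‖ₑ ^ 2)⁻¹ * ∫⁻ w, Φ (-w) * N (r + R) (z - w), ?_, ?_, fun z v hv => ?_⟩
  · refine Measurable.const_mul ?_ _
    exact Measurable.lintegral_prod_right' (f := fun p : V × V => Φ (-p.2) * N (r + R) (p.1 - p.2))
      ((hΦm.comp measurable_snd.neg).mul ((hNm _).comp (measurable_fst.sub measurable_snd)))
  · have hm : Measurable (Function.uncurry fun z w : V => Φ (-w) * N (r + R) (z - w)) :=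
      (hΦm.comp measurable_snd.neg).mul ((hNm _).comp (measurable_fst.sub measurable_snd))
    rw [lintegral_const_mul' _ _ (by simp [hφe]), lintegral_lintegral_swap hm.aemeasurable]
    have h1 : ∀ w, ∫⁻ z, Φ (-w) * N (r + R) (z - w) = Φ (-w) * ∫⁻ z, N (r + R) z := fun w => by
      rw [lintegral_const_mul' _ _ (by simp [hΦ]), lintegral_sub_right_eq_self (N (r + R))]
    simp only [h1]
    rw [lintegral_mul_const' _ _ (hNint _)]
    exact ENNReal.mul_ne_top (by simp [hφe]) (ENNReal.mul_ne_top hΦint (hNint _))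
  · rw [← ENNReal.mul_le_iff_le_inv (by simp [hφe]) (by simp)]
    have h1 := hπ.enorm_inner_mul_le φ g (π.op (z + v) g)
    have h2 : ‖inner ℂ g (π.op (z + v) g)‖ₑ = ‖π.amb g (z + v)‖ₑ := by
      rw [← ofReal_norm, norm_inner_symm, ← ofReal_norm, Real.norm_of_nonneg (π.amb_nonneg _ _)]
      rfl
    rw [h2] at h1
    refine h1.trans (lintegral_mono fun w => ?_)
    have h3 : ‖inner ℂ (π.op w φ) g‖ₑ = Φ (-w) := by
      rw [← ofReal_norm, norm_inner_op_left, ofReal_norm]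
    have h4 : ‖inner ℂ (π.op w φ) (π.op (z + v) g)‖ₑ = Φ (z - w + v) := by
      rw [← ofReal_norm, norm_inner_op_op, ofReal_norm, hΦ]
      simp only
      congr 4
      abel
    simp only [h3, h4]
    gcongr
    exact hNshift _ _ hv

end Majorant

end ProjRep

end Gabor

end

/-! ### Fine lattices generate frames. -/

noncomputable section

namespace Gabor

namespace ProjRep

section Fine

variable {J H : Type*} [Fintype J] [NormedAddCommGroup H] [InnerProductSpace ℂ H]
  {π : ProjRep (EuclideanSpace ℝ J) H}

/-- The orbit of `g` under the lattice generated by `B`. -/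
def orbit (π : ProjRep (EuclideanSpace ℝ J) H) (B : Matrix J J ℝ) (g : H) (j : J → ℤ) : H :=
  π.op (latPt B (intPt j)) g

theorem norm_inner_orbit (B : Matrix J J ℝ) (g : H) (j k : J → ℤ) :
    ‖inner ℂ (π.orbit B g j) (π.orbit B g k)‖ = π.amb g (latPt B (intPt (k - j))) := by
  rw [orbit, orbit, norm_inner_op_op_self, intPt_sub, latPt_sub]

theorem tsum_enorm_sq {ι : Type*} {x : ι → ℂ} (hx : Summable fun i => ‖x i‖ ^ 2) :
    ∑' i, ‖x i‖ₑ ^ 2 = ENNReal.ofReal (∑' i, ‖x i‖ ^ 2) := by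
  rw [ENNReal.ofReal_tsum_of_nonneg (fun _ => by positivity) hx]
  refine tsum_congr fun i => ?_
  rw [ENNReal.ofReal_pow (norm_nonneg _), ofReal_norm]

/-- Expanding both slots gives four inner products whose moduli are values of `amb g`, as phases
disappear. -/
theorem amb_sub_op_le (g : H) (x z : EuclideanSpace ℝ J) :
    π.amb (g - π.op x g) z ≤
      π.amb g z + π.amb g (z - x) + π.amb g (z + x) + π.amb g z := by
  have h1 : inner ℂ (π.op z (g - π.op x g)) (g - π.op x g) =
      inner ℂ (π.op z g) g - inner ℂ (π.op z g) (π.op x g)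
        - inner ℂ (π.op z (π.op x g)) g + inner ℂ (π.op z (π.op x g)) (π.op x g) := by
    rw [map_sub, inner_sub_left, inner_sub_right, inner_sub_right]; ring
  have h2 : ‖inner ℂ (π.op z g) (π.op x g)‖ = π.amb g (z - x) := by
    rw [norm_inner_op_op_self, ← amb_neg, neg_sub]
  have h3 : ‖inner ℂ (π.op z (π.op x g)) g‖ = π.amb g (z + x) := by
    rw [← norm_inner_op_add_right, amb]
  have h4 : ‖inner ℂ (π.op z (π.op x g)) (π.op x g)‖ = π.amb g z := by
    rw [← norm_inner_op_add_right, norm_inner_op_op_self, ← amb_neg]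
    congr 1; abel
  rw [amb, h1]
  refine (norm_add_le _ _).trans (add_le_add ((norm_sub_le _ _).trans
    (add_le_add ((norm_sub_le _ _).trans (add_le_add le_rfl h2.le)) h3.le)) h4.le)

theorem amb_le_norm_sq (g : H) (z : EuclideanSpace ℝ J) : π.amb g z ≤ ‖g‖ ^ 2 := by
  refine (norm_inner_le_norm _ _).trans ?_
  rw [LinearIsometry.norm_map, sq]

/-- The fundamental cell of the lattice generated by `B` lies in the ball of radius `δ`. -/
def IsFine (B : Matrix J J ℝ) (δ : ℝ) : Prop := ∀ v ∈ unitCube J, ‖latPt B v‖ ≤ δ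

/-- Dominated convergence as `η → 0`. It applies to the error window `g - π(x)g`, whose ambiguity
function is dominated by a fixed integrable function and is also uniformly small. -/
theorem exists_lintegral_min_le {V : Type*} [MeasureSpace V] {M : V → ℝ≥0∞} (hM : Measurable M)
    (hMint : ∫⁻ z, M z ≠ ∞) {κ : ℝ} (hκ : 0 < κ) :
    ∃ η : ℝ, 0 < η ∧ ∫⁻ z, min (M z) (ENNReal.ofReal η) ≤ ENNReal.ofReal κ := by
  have h1 : Filter.Tendsto (fun η : ℝ => ∫⁻ z, min (M z) (ENNReal.ofReal η)) (𝓝[>] 0)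
      (𝓝 (∫⁻ z : V, 0)) := by
    refine tendsto_lintegral_filter_of_dominated_convergence M
      (Filter.Eventually.of_forall fun η => hM.min measurable_const)
      (Filter.Eventually.of_forall fun η => Filter.Eventually.of_forall fun z => min_le_left _ _)
      hMint (Filter.Eventually.of_forall fun z => ?_)
    have h2 : Filter.Tendsto (fun η : ℝ => min (M z) (ENNReal.ofReal η)) (𝓝 0)
        (𝓝 (min (M z) (ENNReal.ofReal 0))) :=
      (continuous_const.min ENNReal.continuous_ofReal).tendsto 0
    simp only [ENNReal.ofReal_zero, zero_le, inf_of_le_right] at h2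
    exact h2.mono_left nhdsWithin_le_nhds
  simp only [lintegral_zero] at h1
  have h2 := h1.eventually_le_const (show 0 < ENNReal.ofReal κ by simpa using hκ)
  obtain ⟨η, hη, h⟩ := (h2.and self_mem_nhdsWithin).exists
  exact ⟨η, h, hη⟩

variable [DecidableEq J]

/-- Gram entries of an orbit depend only on index differences, up to phase, so each row sum is
bounded by the full lattice sum of the ambiguity function. -/
theorem isBessel_orbit {B : Matrix J J ℝ} (hB : B.det ≠ 0) {g : H} {C : ℝ} (hC : 0 ≤ C)
    (h : ENNReal.ofReal |B.det| * ∑' j : J → ℤ, ‖π.amb g (latPt B (intPt j))‖ₑ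
      ≤ ENNReal.ofReal C) : IsBessel (π.orbit B g) (C / |B.det|) := by
  have hB' : 0 < |B.det| := abs_pos.2 hB
  refine isBessel_of_gram (by positivity) fun s i _ => ?_
  rw [le_div_iff₀' hB', ← ENNReal.ofReal_le_ofReal_iff hC, ENNReal.ofReal_mul hB'.le]
  refine le_trans ?_ h
  gcongr
  rw [ENNReal.ofReal_sum_of_nonneg fun _ _ => norm_nonneg _]
  refine le_trans (le_of_eq ?_) (ENNReal.sum_le_tsum (s.map (Equiv.subRight i).toEmbedding))
  rw [Finset.sum_map]
  refine Finset.sum_congr rfl fun j _ => ?_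
  rw [norm_inner_orbit, ← ofReal_norm, Real.norm_of_nonneg (π.amb_nonneg _ _)]
  rfl

/-- Moyal's relation unfolded over the cells: an exact value for the frame sum averaged over shifts
of the window. Both the lower bound for fine lattices and the density theorem rest on it. -/
theorem Moyal.lattice (hπ : π.Moyal) {B : Matrix J J ℝ} (hB : B.det ≠ 0) (f g : H) :
    ENNReal.ofReal |B.det| * ∫⁻ v in unitCube J, ∑' j : J → ℤ,
      ‖inner ℂ (π.orbit B (π.op (latPt B v) g) j) f‖ₑ ^ 2 = ‖f‖ₑ ^ 2 * ‖g‖ₑ ^ 2 := by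
  rw [← hπ, lintegral_eq_det_mul_lintegral_tsum hB
    (((π.continuous_op g).inner continuous_const).enorm.measurable.pow_const 2)]
  congr 1
  refine lintegral_congr fun v => tsum_congr fun j => ?_
  rw [← ofReal_norm, ← ofReal_norm, latPt_add, norm_inner_op_add_right, orbit]

theorem isBessel_orbit_sub {g : H} {M : EuclideanSpace ℝ J → ℝ≥0∞} (hM : Measurable M)
    (hMg : ∀ z v, ‖v‖ ≤ 2 → ‖π.amb g (z + v)‖ₑ ≤ M z) {κ η : ℝ} (hκ : 0 ≤ κ)
    (hint : ∫⁻ z, min (4 * M z) (ENNReal.ofReal η) ≤ ENNReal.ofReal κ)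
    {B : Matrix J J ℝ} (hB : B.det ≠ 0) (hfine : IsFine B 1) {v : J → ℝ} (hv : v ∈ unitCube J)
    (hnear : ‖g - π.op (latPt B v) g‖ ^ 2 ≤ η) :
    IsBessel (π.orbit B (g - π.op (latPt B v) g)) (κ / |B.det|) := by
  refine isBessel_orbit hB hκ (le_trans (det_mul_tsum_le hB
    ((hM.const_mul 4).min measurable_const) fun j w hw => ?_) hint)
  refine le_min ?_ ?_
  · set x := latPt B v
    set y := latPt B w
    set z := latPt B (intPt j)
    have hx : ‖x‖ ≤ 1 := hfine v hv
    have hy : ‖y‖ ≤ 1 := hfine w hw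
    rw [latPt_add]
    -- The base point `z + y` and the evaluation point `z + a` are both within one of `z`, whence
    -- the radius 2 in the majorant.
    have h0 : ∀ a : EuclideanSpace ℝ J, ‖a‖ ≤ 1 →
        ENNReal.ofReal (π.amb g (z + a)) ≤ M (z + y) := by
      intro a ha
      have h := hMg (z + y) (a - y) ((norm_sub_le _ _).trans (by linarith))
      rw [show z + y + (a - y) = z + a by abel] at h
      rwa [← ofReal_norm, Real.norm_of_nonneg (π.amb_nonneg _ _)] at h
    rw [← ofReal_norm, Real.norm_of_nonneg (π.amb_nonneg _ _)]
    refine (ENNReal.ofReal_le_ofReal (amb_sub_op_le g x z)).trans ?_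
    have hn := fun z => π.amb_nonneg g z
    rw [ENNReal.ofReal_add (add_nonneg (add_nonneg (hn _) (hn _)) (hn _)) (hn _),
      ENNReal.ofReal_add (add_nonneg (hn _) (hn _)) (hn _), ENNReal.ofReal_add (hn _) (hn _)]
    have e0 := h0 0 (by simp)
    have e1 := h0 (-x) (by simpa using hx)
    have e2 := h0 x hx
    rw [add_zero] at e0
    rw [← sub_eq_add_neg] at e1
    refine (add_le_add (add_le_add (add_le_add e0 e1) e2) e0).trans (le_of_eq ?_)
    ring
  · rw [← ofReal_norm, Real.norm_of_nonneg (π.amb_nonneg _ _)]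
    exact ENNReal.ofReal_le_ofReal ((amb_le_norm_sq _ _).trans hnear)

variable [CompleteSpace H]

/-- All sufficiently fine lattices give frames, with uniform constants. -/
theorem exists_fine_frame (hπ : π.Moyal) {g : H} (hg : g ≠ 0)
    (hint : ∫⁻ z, ‖π.amb g z‖ₑ ≠ ∞) :
    ∃ δ C : ℝ, 0 < δ ∧ δ ≤ 1 ∧ 0 ≤ C ∧ ∀ B : Matrix J J ℝ, B.det ≠ 0 → IsFine B δ →
      IsBessel (π.orbit B g) (C / |B.det|) ∧ ∀ f, ‖g‖ ^ 2 / 4 / |B.det| * ‖f‖ ^ 2 ≤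
        ∑' j, ‖inner ℂ (π.orbit B g j) f‖ ^ 2 := by
  obtain ⟨M, hM, hMint, hMg⟩ := exists_majorant hπ hg hint 2
  have hgn : 0 < ‖g‖ := norm_pos_iff.2 hg
  -- Averaging will give `‖f‖²‖g‖² ≤ 2|det B| S + 2κ‖f‖²` for the frame sum `S`; this `κ` absorbs
  -- half of the left side.
  set κ := ‖g‖ ^ 2 / 4 with hκ
  obtain ⟨η, hη, hηκ⟩ := exists_lintegral_min_le (hM.const_mul 4)
    (by rw [lintegral_const_mul _ hM]; exact ENNReal.mul_ne_top (by simp) hMint)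
    (show 0 < κ by positivity)
  have hc : Filter.Tendsto (fun x => ‖g - π.op x g‖ ^ 2) (𝓝 0) (𝓝 0) := by
    have h1 : Continuous fun x => ‖g - π.op x g‖ ^ 2 :=
      (continuous_const.sub (π.continuous_op g)).norm.pow 2
    have := h1.tendsto 0
    simpa [π.op_zero] using this
  obtain ⟨ρ, hρ, hball⟩ := Metric.nhds_basis_closedBall.eventually_iff.1
    (hc.eventually_le_const hη)
  refine ⟨min ρ 1, (∫⁻ z, M z).toReal, lt_min hρ one_pos, min_le_right _ _,
    ENNReal.toReal_nonneg, fun B hB hfine => ?_⟩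
  have hfine1 : IsFine B 1 := fun v hv => (hfine v hv).trans (min_le_right _ _)
  have hB' : 0 < |B.det| := abs_pos.2 hB
  have hbes : IsBessel (π.orbit B g) ((∫⁻ z, M z).toReal / |B.det|) := by
    refine isBessel_orbit hB ENNReal.toReal_nonneg ?_
    rw [ENNReal.ofReal_toReal hMint]
    refine det_mul_tsum_le hB hM fun j v hv => ?_
    rw [latPt_add]
    have := hMg (latPt B (intPt j) + latPt B v) (-latPt B v)
      (by rw [norm_neg]; linarith [hfine1 v hv])
    rwa [add_neg_cancel_right] at this
  refine ⟨hbes, fun f => ?_⟩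
  set S := ∑' j, ‖inner ℂ (π.orbit B g j) f‖ ^ 2 with hS
  have hS0 : 0 ≤ S := tsum_nonneg fun _ => by positivity
  -- Split `π(Bv)g = g - (g - π(Bv)g)` and use `|x - y|² ≤ 2|x|² + 2|y|²`; the error window has
  -- Bessel bound `κ/|det B|`.
  have hv : ∀ v ∈ unitCube J, ∑' j : J → ℤ, ‖inner ℂ (π.orbit B (π.op (latPt B v) g) j) f‖ₑ ^ 2 ≤
      ENNReal.ofReal (2 * S + 2 * (κ / |B.det| * ‖f‖ ^ 2)) := by
    intro v hv
    have hb := isBessel_orbit_sub hM hMg (κ := κ) (by positivity) hηκ hB hfine1 hv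
      (hball (by simpa using (hfine v hv).trans (min_le_left _ _)))
    have hsum := (hbes.summable f).mul_left 2 |>.add ((hb.summable f).mul_left 2)
    have hle : ∀ j, ‖inner ℂ (π.orbit B (π.op (latPt B v) g) j) f‖ ^ 2 ≤
        2 * ‖inner ℂ (π.orbit B g j) f‖ ^ 2 +
        2 * ‖inner ℂ (π.orbit B (g - π.op (latPt B v) g) j) f‖ ^ 2 := by
      intro j
      have e : inner ℂ (π.orbit B (π.op (latPt B v) g) j) f = inner ℂ (π.orbit B g j) f -
          inner ℂ (π.orbit B (g - π.op (latPt B v) g) j) f := by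
        simp only [orbit, map_sub, inner_sub_left]; ring
      rw [e]
      have := norm_sub_le (inner ℂ (π.orbit B g j) f)
        (inner ℂ (π.orbit B (g - π.op (latPt B v) g) j) f)
      nlinarith [norm_nonneg (inner ℂ (π.orbit B g j) f -
          inner ℂ (π.orbit B (g - π.op (latPt B v) g) j) f),
        sq_nonneg (‖inner ℂ (π.orbit B g j) f‖ - 
          ‖inner ℂ (π.orbit B (g - π.op (latPt B v) g) j) f‖)]
    have hs := Summable.of_nonneg_of_le (fun _ => by positivity) hle hsum
    rw [tsum_enorm_sq hs]
    refine ENNReal.ofReal_le_ofReal ((hs.tsum_le_tsum hle hsum).trans ?_)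
    rw [Summable.tsum_add ((hbes.summable f).mul_left 2) ((hb.summable f).mul_left 2),
      tsum_mul_left, tsum_mul_left]
    gcongr
    exact hb.tsum_le f
  have h1 := hπ.lattice hB f g
  have h2 : ‖f‖ₑ ^ 2 * ‖g‖ₑ ^ 2 ≤ ENNReal.ofReal |B.det| * 
      ENNReal.ofReal (2 * S + 2 * (κ / |B.det| * ‖f‖ ^ 2)) := by
    rw [← h1]
    gcongr
    refine (setLIntegral_mono' measurableSet_unitCube hv).trans (le_of_eq ?_)
    simp [volume_unitCube]
  rw [← ofReal_norm, ← ofReal_norm, ← ENNReal.ofReal_pow (norm_nonneg _),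
    ← ENNReal.ofReal_pow (norm_nonneg _), ← ENNReal.ofReal_mul (by positivity),
    ← ENNReal.ofReal_mul (by positivity), ENNReal.ofReal_le_ofReal_iff (by positivity)] at h2
  have h3 : |B.det| * (2 * S + 2 * (κ / |B.det| * ‖f‖ ^ 2)) =
      2 * (|B.det| * S) + 2 * κ * ‖f‖ ^ 2 := by field_simp
  rw [h3] at h2
  rw [div_mul_eq_mul_div, div_le_iff₀ hB']
  nlinarith

end Fine

end ProjRep

end Gabor

end

/-! ### Covariance under the lattice, and the density theorem. -/

noncomputable section

namespace Gabor

namespace ProjRep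

section Covariance

variable {J H : Type*} [Fintype J] [NormedAddCommGroup H] [InnerProductSpace ℂ H]
  {π : ProjRep (EuclideanSpace ℝ J) H}

theorem orbit_zero (B : Matrix J J ℝ) (g : H) : π.orbit B g 0 = g := by
  simp [orbit, π.op_zero]

theorem exists_orbit_add (B : Matrix J J ℝ) (k j : J → ℤ) : ∃ c : ℂ, ‖c‖ = 1 ∧ ∀ g,
    π.orbit B g (k + j) = c • π.op (latPt B (intPt k)) (π.orbit B g j) := by
  obtain ⟨c, hc, h⟩ := π.exists_op_add (latPt B (intPt k)) (latPt B (intPt j))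
  exact ⟨c, hc, fun g => by rw [orbit, intPt_add, latPt_add, h, orbit]⟩

theorem norm_inner_orbit_add (B : Matrix J J ℝ) (g f : H) (k j : J → ℤ) :
    ‖inner ℂ (π.orbit B g (k + j)) (π.op (latPt B (intPt k)) f)‖ =
      ‖inner ℂ (π.orbit B g j) f‖ := by
  obtain ⟨c, hc, h⟩ := π.exists_orbit_add B k j
  rw [h, inner_smul_left, LinearIsometry.inner_map_map]
  simp [hc]

theorem tsum_norm_inner_orbit_op (B : Matrix J J ℝ) (g f : H) (k : J → ℤ) :
    ∑' j, ‖inner ℂ (π.orbit B g j) (π.op (latPt B (intPt k)) f)‖ ^ 2 =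
      ∑' j, ‖inner ℂ (π.orbit B g j) f‖ ^ 2 := by
  rw [← (Equiv.addLeft k).tsum_eq]
  simp only [Equiv.coe_addLeft, norm_inner_orbit_add]

theorem norm_inner_orbit_op (B : Matrix J J ℝ) (g f : H) (v : J → ℝ) (j : J → ℤ) :
    ‖inner ℂ (π.orbit B (π.op (latPt B v) g) j) f‖ =
      ‖inner ℂ (π.orbit B g j) (π.op (-latPt B v) f)‖ := by
  rw [orbit, ← norm_inner_op_add_right, add_comm, norm_inner_op_add_right, norm_inner_op_left,
    orbit]

variable [CompleteSpace H]

/-- A lattice shift permutes the orbit up to phases, and each phase meets its own conjugate in the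
frame sum. Hence the dual family is again an orbit, that of `S⁻¹g`. -/
theorem frameOp_op {B : Matrix J J ℝ} {g : H} {C : ℝ} (h : IsBessel (π.orbit B g) C)
    (k : J → ℤ) (f : H) : frameOp _ h (π.op (latPt B (intPt k)) f) =
      π.op (latPt B (intPt k)) (frameOp _ h f) := by
  set P := π.op (latPt B (intPt k))
  refine ext_inner_left ℂ fun f' => ?_
  obtain ⟨b, hb, hf'⟩ := π.exists_op_neg (latPt B (intPt k))
  rw [hf' f', ← map_smul]
  set f₁ := b • π.op (-latPt B (intPt k)) f'
  change inner ℂ (P f₁) _ = inner ℂ (P f₁) _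
  rw [LinearIsometry.inner_map_map]
  refine ((Equiv.addLeft k).hasSum_iff.2 (hasSum_inner_frameOp h (P f₁) (P f))).unique
    ((hasSum_inner_frameOp h f₁ f).congr_fun fun j => ?_)
  obtain ⟨c, hc, hj⟩ := π.exists_orbit_add B k j
  simp only [Function.comp_apply, Equiv.coe_addLeft]
  rw [hj, inner_smul_left, inner_smul_right, LinearIsometry.inner_map_map,
    LinearIsometry.inner_map_map]
  have hcc : c * (starRingEnd ℂ) c = 1 := by rw [RCLike.mul_conj, hc]; simp
  linear_combination (inner ℂ f₁ (π.orbit B g j) * inner ℂ (π.orbit B g j) f) * hcc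

variable [DecidableEq J]

/-- The density theorem: a frame over a lattice forces the volume of the lattice to be at
most one. -/
theorem abs_det_le_one (hπ : π.Moyal) {g : H} (hg : g ≠ 0) {B : Matrix J J ℝ} (hB : B.det ≠ 0)
    {C a : ℝ} (h : IsBessel (π.orbit B g) C) (ha : 0 < a)
    (hlow : ∀ f, a * ‖f‖ ^ 2 ≤ ∑' j, ‖inner ℂ (π.orbit B g j) f‖ ^ 2) : |B.det| ≤ 1 := by
  set S := frameOp _ h with hS
  have hsurj := ((ContinuousLinearMap.isUnit_iff_bijective).1 (isUnit_frameOp h ha hlow)).2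
  obtain ⟨γ, hγ⟩ : ∃ γ, S γ = g := hsurj g
  have hSγ : ∀ j, S (π.orbit B γ j) = π.orbit B g j := fun j => by
    rw [orbit, hS, frameOp_op, ← hS, hγ, orbit]
  -- Polarized form of `∑ ⟨f, π(λ)g⟩⟨π(λ)γ, f⟩ = ‖f‖²`, arranged so that only nonnegative sums occur
  -- and Moyal's relation applies to `g + γ` and `g - γ` separately.
  have hkey : ∀ f, ∑' j, ‖inner ℂ (π.orbit B (g + γ) j) f‖ₑ ^ 2 =
      ∑' j, ‖inner ℂ (π.orbit B (g - γ) j) f‖ₑ ^ 2 + ENNReal.ofReal (4 * ‖f‖ ^ 2) := by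
    intro f
    obtain ⟨f', rfl⟩ : ∃ f', S f' = f := hsurj f
    have hγj : ∀ j, inner ℂ (π.orbit B γ j) (S f') = inner ℂ (π.orbit B g j) f' := fun j => by
      rw [hS, ← inner_frameOp_comm, ← hS, hSγ]
    have hadd : ∀ j, inner ℂ (π.orbit B (g + γ) j) (S f') =
        inner ℂ (π.orbit B g j) (S f' + f') := fun j => by
      rw [inner_add_right, ← hγj, orbit, map_add, inner_add_left]; rfl
    have hsub : ∀ j, inner ℂ (π.orbit B (g - γ) j) (S f') =
        inner ℂ (π.orbit B g j) (S f' - f') := fun j => by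
      rw [inner_sub_right, ← hγj, orbit, map_sub, inner_sub_left]; rfl
    simp only [hadd, hsub]
    rw [tsum_enorm_sq (h.summable _), tsum_enorm_sq (h.summable _),
      ← ENNReal.ofReal_add (tsum_nonneg fun _ => by positivity) (by positivity),
      (hasSum_norm_sq_frameOp h _).tsum_eq, (hasSum_norm_sq_frameOp h _).tsum_eq]
    congr 1
    rw [← hS, map_add, map_sub]
    have e1 : inner ℂ f' (S (S f')) = inner ℂ (S f') (S f') := (inner_frameOp_comm h _ _).symm
    have e2 : RCLike.re (inner ℂ (S f') (S f')) = ‖S f'‖ ^ 2 := inner_self_eq_norm_sq _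
    simp only [inner_add_left, inner_add_right, inner_sub_left, inner_sub_right, map_add, map_sub,
      e1, e2]
    ring
  have hv : ∀ v, ∑' j, ‖inner ℂ (π.orbit B (π.op (latPt B v) (g + γ)) j) g‖ₑ ^ 2 =
      ∑' j, ‖inner ℂ (π.orbit B (π.op (latPt B v) (g - γ)) j) g‖ₑ ^ 2 +
        ENNReal.ofReal (4 * ‖g‖ ^ 2) := by
    intro v
    have := hkey (π.op (-latPt B v) g)
    simp only [← ofReal_norm, norm_inner_orbit_op, LinearIsometry.norm_map] at this ⊢
    exact this
  have h1 := hπ.lattice hB g (g + γ)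
  simp only [hv] at h1
  rw [lintegral_add_right _ measurable_const, mul_add, hπ.lattice hB g (g - γ)] at h1
  simp only [lintegral_const, MeasurableSet.univ, Measure.restrict_apply, Set.univ_inter,
    volume_unitCube, mul_one] at h1
  simp only [← ofReal_norm, ← ENNReal.ofReal_pow (norm_nonneg _)] at h1
  rw [← ENNReal.ofReal_mul (by positivity), ← ENNReal.ofReal_mul (by positivity),
    ← ENNReal.ofReal_mul (by positivity), ← ENNReal.ofReal_add (by positivity) (by positivity),
    ENNReal.ofReal_eq_ofReal_iff (by positivity) (by positivity)] at h1
  have hgn : 0 < ‖g‖ ^ 2 := pow_pos (norm_pos_iff.2 hg) 2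
  -- From `‖g + γ‖² - ‖g - γ‖² = 4 Re⟨g, γ⟩`, after cancelling `‖g‖²`.
  have h2 : RCLike.re (inner ℂ g γ) = |B.det| := by
    have e1 := norm_add_sq (𝕜 := ℂ) g γ
    have e2 := norm_sub_sq (𝕜 := ℂ) g γ
    rw [e1, e2] at h1
    have : ‖g‖ ^ 2 * (RCLike.re (inner ℂ g γ) - |B.det|) = 0 := by linarith
    rcases mul_eq_zero.1 this with h0 | h0
    · exact absurd h0 hgn.ne'
    · linarith
  -- The term at the origin is at most the full frame sum of `γ`, which is `Re⟨γ, Sγ⟩ = Re⟨γ, g⟩`.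
  have h3 : ‖inner ℂ g γ‖ ^ 2 ≤ RCLike.re (inner ℂ g γ) := by
    have e := hasSum_norm_sq_frameOp h γ
    rw [← hS, hγ] at e
    have := le_hasSum e 0 (fun _ _ => by positivity)
    rwa [orbit_zero, inner_re_symm] at this
  have h4 : RCLike.re (inner ℂ g γ) ≤ ‖inner ℂ g γ‖ := RCLike.re_le_norm _
  rw [h2] at h3 h4
  have hB' : 0 < |B.det| := abs_pos.2 hB
  nlinarith

end Covariance

end ProjRep

end Gabor

end

/-! ### Localization of quadratic forms to boxes. -/

noncomputable section

namespace Gabor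

section Windows

variable {J H : Type*} [NormedAddCommGroup H] [InnerProductSpace ℂ H]

theorem inner_sum_smul_apply (W : H →L[ℂ] H) (v : (J → ℤ) → H) (s : Finset (J → ℤ))
    (x : (J → ℤ) → ℂ) : inner ℂ (∑ m ∈ s, x m • v m) (W (∑ m ∈ s, x m • v m)) =
      ∑ m ∈ s, ∑ n ∈ s, (starRingEnd ℂ) (x m) * x n * inner ℂ (v m) (W (v n)) := by
  rw [map_sum, sum_inner]
  refine Finset.sum_congr rfl fun m _ => ?_
  rw [inner_sum]
  refine Finset.sum_congr rfl fun n _ => ?_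
  rw [map_smul, inner_smul_left, inner_smul_right]
  ring

variable [Fintype J]

/-- The size of `t`, relative to `R`, cut off at one. -/
def relSize (R : ℕ) (t : J → ℤ) : ℝ := min 1 ((∑ i, |(t i : ℝ)|) / R)

theorem relSize_nonneg (R : ℕ) (t : J → ℤ) : 0 ≤ relSize R t := by
  unfold relSize; positivity

/-- Subadditivity lets the weight pass through the convolution in `sum_off_diagonal_le`. -/
theorem relSize_add_le (R : ℕ) (t t' : J → ℤ) :
    relSize R (t + t') ≤ relSize R t + relSize R t' := by
  have h : (∑ i, |((t + t') i : ℝ)|) / R ≤ (∑ i, |(t i : ℝ)|) / R + (∑ i, |(t' i : ℝ)|) / R := by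
    rw [← add_div, ← Finset.sum_add_distrib]
    gcongr with i
    simpa using abs_add_le (t i : ℝ) (t' i)
  have h1 : 0 ≤ (∑ i, |(t i : ℝ)|) / R := by positivity
  have h2 : 0 ≤ (∑ i, |(t' i : ℝ)|) / R := by positivity
  unfold relSize
  rcases min_cases 1 ((∑ i, |(t i : ℝ)|) / R) with h3 | h3 <;>
  rcases min_cases 1 ((∑ i, |(t' i : ℝ)|) / R) with h4 | h4 <;>
  rw [h3.1, h4.1]
  · exact (min_le_left _ _).trans (by linarith)
  · exact (min_le_left _ _).trans (by linarith)
  · exact (min_le_left _ _).trans (by linarith)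
  · exact (min_le_right _ _).trans h

theorem card_filter_Ico_le (R : ℕ) (t : ℤ) :
    ((Finset.Ico 0 (R : ℤ)).filter fun x => ¬(0 ≤ x + t ∧ x + t < R)).card ≤ t.natAbs := by
  rcases le_total 0 t with ht | ht
  · refine (Finset.card_le_card (t := Finset.Ico (R - t) (R : ℤ)) fun x hx => ?_).trans ?_
    · simp only [Finset.mem_filter, Finset.mem_Ico] at hx ⊢; omega
    · simp only [Int.card_Ico]; omega
  · refine (Finset.card_le_card (t := Finset.Ico 0 (-t)) fun x hx => ?_).trans ?_
    · simp only [Finset.mem_filter, Finset.mem_Ico] at hx ⊢; omega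
    · simp only [Int.card_Ico]; omega

variable [DecidableEq J]

/-- The discrete box `{0, …, R - 1}^J`. -/
def box (J : Type*) [Fintype J] [DecidableEq J] (R : ℕ) : Finset (J → ℤ) :=
  Fintype.piFinset fun _ => Finset.Ico 0 (R : ℤ)

theorem mem_box {R : ℕ} {m : J → ℤ} : m ∈ box J R ↔ ∀ i, 0 ≤ m i ∧ m i < R := by
  simp [box, Fintype.mem_piFinset]

/-- A point leaving the box under the shift leaves it in some coordinate `i`, where at most `|t i|`
of the `R` values are possible. -/
theorem card_box_shift_mul_le (R : ℕ) (t : J → ℤ) :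
    ((box J R).filter fun b => b + t ∉ box J R).card * R ≤
      (box J R).card * ∑ i, (t i).natAbs := by
  let S : J → Finset ℤ := fun i =>
    (Finset.Ico 0 (R : ℤ)).filter fun x => ¬(0 ≤ x + t i ∧ x + t i < R)
  let P : J → Finset (J → ℤ) := fun i =>
    Fintype.piFinset (Function.update (fun _ => Finset.Ico 0 (R : ℤ)) i (S i))
  have h1 : ((box J R).filter fun b => b + t ∉ box J R) ⊆ Finset.univ.biUnion P := by
    intro b hb
    simp only [Finset.mem_filter, mem_box, not_forall, Pi.add_apply] at hb
    obtain ⟨hb, i, hi⟩ := hb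
    simp only [Finset.mem_biUnion, Finset.mem_univ, true_and, P, Fintype.mem_piFinset]
    refine ⟨i, fun j => ?_⟩
    rcases eq_or_ne j i with rfl | hj
    · simpa [S] using ⟨hb j, fun h => by omega⟩
    · simpa [hj] using hb j
  have h2 : ∀ i, (P i).card * R ≤ (box J R).card * (t i).natAbs := by
    intro i
    have e1 : (P i).card = (S i).card * ∏ _j ∈ Finset.univ \ {i}, R := by
      rw [Fintype.card_piFinset]
      have : ∀ j, (Function.update (fun _ => Finset.Ico 0 (R : ℤ)) i (S i) j).card =
          Function.update (fun _ => R) i (S i).card j := by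
        intro j
        rcases eq_or_ne j i with rfl | hj
        · simp
        · simp [hj]
      simp only [this]
      rw [Finset.prod_update_of_mem (Finset.mem_univ i)]
    have e2 : (box J R).card = R * ∏ _j ∈ Finset.univ \ {i}, R := by
      rw [box, Fintype.card_piFinset]
      simp only [Int.card_Ico, sub_zero, Int.toNat_natCast]
      rw [← Finset.mul_prod_erase _ _ (Finset.mem_univ i), Finset.sdiff_singleton_eq_erase]
    rw [e1, e2]
    calc _ = (S i).card * (R * ∏ _j ∈ Finset.univ \ {i}, R) := by ring
      _ ≤ (t i).natAbs * (R * ∏ _j ∈ Finset.univ \ {i}, R) := by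
        gcongr; exact card_filter_Ico_le R (t i)
      _ = _ := by ring
  calc _ ≤ (∑ i, (P i).card) * R := by
        gcongr; exact (Finset.card_le_card h1).trans Finset.card_biUnion_le
    _ ≤ ∑ i, (box J R).card * (t i).natAbs := by
        rw [Finset.sum_mul]; exact Finset.sum_le_sum fun i _ => h2 i
    _ = _ := by rw [Finset.mul_sum]

theorem card_box_shift_le {R : ℕ} (hR : 0 < R) (t : J → ℤ) :
    (((box J R).filter fun b => b + t ∉ box J R).card : ℝ) ≤ (box J R).card * relSize R t := by
  rw [relSize, mul_min_of_nonneg _ _ (by positivity), mul_one]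
  refine le_min (by exact_mod_cast Finset.card_filter_le _ _) ?_
  rw [← mul_div_assoc, le_div_iff₀ (by exact_mod_cast hR)]
  have := card_box_shift_mul_le R t
  have h2 : (((box J R).filter fun b => b + t ∉ box J R).card * R : ℝ) ≤
      (box J R).card * ∑ i, ((t i).natAbs : ℝ) := by exact_mod_cast this
  simpa [Nat.cast_natAbs] using h2

/-- Localization of a quadratic form with off-diagonal decay: lower bounds for coefficient
sequences supported in boxes of side `R` give a global lower bound. -/
theorem le_re_inner_of_local {W : H →L[ℂ] H} {v : (J → ℤ) → H} {R : ℕ} (hR : 0 < R) {ε : ℝ}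
    {s : Finset (J → ℤ)} (hsymm : ∀ m n, ‖inner ℂ (v m) (W (v n))‖ = ‖inner ℂ (v n) (W (v m))‖)
    (hoff : ∀ m ∈ s, ∑ n ∈ s, ‖inner ℂ (v m) (W (v n))‖ * relSize R (n - m) ≤ ε)
    (hloc : ∀ (z : J → ℤ) (x : (J → ℤ) → ℂ), (∀ m ∈ s, x m ≠ 0 → m - z ∈ box J R) →
      -ε * ∑ m ∈ s, ‖x m‖ ^ 2 ≤
        RCLike.re (inner ℂ (∑ m ∈ s, x m • v m) (W (∑ m ∈ s, x m • v m))))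
    (c : (J → ℤ) → ℂ) : -(2 * ε) * ∑ m ∈ s, ‖c m‖ ^ 2 ≤
        RCLike.re (inner ℂ (∑ m ∈ s, c m • v m) (W (∑ m ∈ s, c m • v m))) := by
  set Q : ((J → ℤ) → ℂ) → ℂ := fun x =>
    inner ℂ (∑ m ∈ s, x m • v m) (W (∑ m ∈ s, x m • v m)) with hQ
  set G : (J → ℤ) → (J → ℤ) → ℂ := fun m n => inner ℂ (v m) (W (v n)) with hG
  obtain ⟨D, hD⟩ : ∃ D, D = box J R := ⟨_, rfl⟩
  rw [← hD] at hloc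
  have hDpos : (0 : ℝ) < D.card := by
    have : 0 < D.card := Finset.card_pos.2 ⟨0, hD ▸ mem_box.2 fun i => by simpa using hR⟩
    exact_mod_cast this
  -- All `z` for which `z + D` meets `s`. Each point of `s` lies in exactly `D.card` of these
  -- translates, and `x z` is `c` cut off to `z + D`.
  set Z : Finset (J → ℤ) := (s ×ˢ D).image fun p => p.1 - p.2 with hZ
  set x : (J → ℤ) → (J → ℤ) → ℂ := fun z m => if m - z ∈ D then c m else 0 with hx
  have hcount : ∀ m ∈ s, ∀ (p : (J → ℤ) → Prop) [DecidablePred p],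
      (Z.filter fun z => m - z ∈ D ∧ p (m - z)).card = (D.filter p).card := by
    intro m hm p _
    refine Finset.card_bij (fun z _ => m - z) (fun z hz => ?_) (fun z _ z' _ h => ?_)
      (fun b hb => ⟨m - b, ?_, by simp⟩)
    · simpa using (Finset.mem_filter.1 hz).2
    · simpa using h
    · rw [Finset.mem_filter] at hb
      simp only [Finset.mem_filter, sub_sub_cancel, hb, hZ, Finset.mem_image, Finset.mem_product,
        and_true]
      exact ⟨(m, b), ⟨hm, hb.1⟩, rfl⟩
  have hcount' : ∀ m ∈ s, (∑ z ∈ Z, if m - z ∈ D then (1 : ℝ) else 0) = D.card := by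
    intro m hm
    have := hcount m hm fun _ => True
    simp only [and_true, Finset.filter_true] at this
    rw [Finset.sum_ite, Finset.sum_const_zero, add_zero, Finset.sum_const, this]
    simp
  have hloc' : -ε * (D.card * ∑ m ∈ s, ‖c m‖ ^ 2) ≤ ∑ z ∈ Z, RCLike.re (Q (x z)) := by
    calc -ε * (D.card * ∑ m ∈ s, ‖c m‖ ^ 2)
        = ∑ z ∈ Z, -ε * ∑ m ∈ s, ‖x z m‖ ^ 2 := by
          rw [← Finset.mul_sum, Finset.sum_comm, Finset.mul_sum]
          congr 1
          refine Finset.sum_congr rfl fun m hm => ?_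
          rw [← hcount' m hm, Finset.sum_mul]
          refine Finset.sum_congr rfl fun z _ => ?_
          simp only [hx]
          split_ifs <;> simp
      _ ≤ _ := Finset.sum_le_sum fun z _ => hloc z (x z) fun m _ hm => by
          by_contra h
          exact hm (by simp [hx, h])
  -- The pair `(m, n)` is lost in the translates containing `m` but not `n`, at most a fraction
  -- `relSize R (n - m)` of `D.card`. Schur's test and `hoff` bound the loss by a second `ε`.
  have hdiff : ‖(D.card : ℂ) * Q c - ∑ z ∈ Z, Q (x z)‖ ≤ ε * (D.card * ∑ m ∈ s, ‖c m‖ ^ 2) := by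
    set N : (J → ℤ) → (J → ℤ) → ℝ := fun m n =>
      ((Z.filter fun z => m - z ∈ D ∧ n - z ∉ D).card : ℝ) with hN
    have e1 : (D.card : ℂ) * Q c - ∑ z ∈ Z, Q (x z) =
        ∑ m ∈ s, ∑ n ∈ s, (starRingEnd ℂ) (c m) * c n * G m n * N m n := by
      simp only [hQ, inner_sum_smul_apply]
      rw [Finset.sum_comm (s := Z), Finset.mul_sum, ← Finset.sum_sub_distrib]
      refine Finset.sum_congr rfl fun m hm => ?_
      rw [Finset.sum_comm (s := Z), Finset.mul_sum, ← Finset.sum_sub_distrib]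
      refine Finset.sum_congr rfl fun n _ => ?_
      have e2 : (D.card : ℂ) = ∑ z ∈ Z, if m - z ∈ D then (1 : ℂ) else 0 := by
        have := congrArg (fun r : ℝ => (r : ℂ)) (hcount' m hm)
        push_cast at this
        rw [← this]
        refine Finset.sum_congr rfl fun z _ => ?_
        split_ifs <;> simp
      have e3 : (N m n : ℂ) = ∑ z ∈ Z, if m - z ∈ D ∧ n - z ∉ D then (1 : ℂ) else 0 := by
        simp [hN]
      rw [e2, e3, Finset.sum_mul, Finset.mul_sum, ← Finset.sum_sub_distrib]
      refine Finset.sum_congr rfl fun z _ => ?_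
      simp only [hx]
      by_cases h1 : m - z ∈ D <;> by_cases h2 : n - z ∈ D <;> simp [h1, h2, hG]
    have hNle : ∀ m ∈ s, ∀ n, N m n ≤ D.card * relSize R (n - m) := by
      intro m hm n
      have h1 := hcount m hm fun b => b + (n - m) ∉ D
      have h2 : ∀ z, m - z + (n - m) = n - z := fun z => by abel
      simp only [h2] at h1
      have h3 := card_box_shift_le hR (n - m)
      rw [← hD, ← h1] at h3
      exact h3
    rw [e1]
    calc _ ≤ ∑ m ∈ s, ∑ n ∈ s, ‖c m‖ * ‖c n‖ * (‖G m n‖ * (D.card * relSize R (n - m))) := by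
          refine (norm_sum_le _ _).trans (Finset.sum_le_sum fun m hm => ?_)
          refine (norm_sum_le _ _).trans (Finset.sum_le_sum fun n _ => ?_)
          have hN0 : 0 ≤ N m n := Nat.cast_nonneg _
          rw [norm_mul, norm_mul, norm_mul, RCLike.norm_conj, mul_assoc, Complex.norm_real,
            Real.norm_of_nonneg hN0]
          exact mul_le_mul_of_nonneg_left (mul_le_mul_of_nonneg_left (hNle m hm n)
            (norm_nonneg _)) (mul_nonneg (norm_nonneg _) (norm_nonneg _))
      _ ≤ (D.card * ε) * ∑ m ∈ s, ‖c m‖ ^ 2 := by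
          refine sum_sum_mul_mul_le (a := fun m n => ‖G m n‖ * (D.card * relSize R (n - m)))
            (x := fun m => ‖c m‖) (C := D.card * ε) (fun m n => mul_nonneg (norm_nonneg _)
            (mul_nonneg (by positivity) (relSize_nonneg _ _))) (fun m n => ?_) fun m hm => ?_
          · have : relSize R (n - m) = relSize R (m - n) := by
              unfold relSize
              congr 3
              ext i
              rw [← abs_neg]
              simp
            simp only [hG]
            rw [hsymm, this]
          · calc _ = D.card * ∑ n ∈ s, ‖G m n‖ * relSize R (n - m) := by
                  rw [Finset.mul_sum]
                  exact Finset.sum_congr rfl fun n _ => by ring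
              _ ≤ _ := by gcongr; exact hoff m hm
      _ = _ := by ring
  have h1 := (RCLike.re_le_norm (-((D.card : ℂ) * Q c - ∑ z ∈ Z, Q (x z)))).trans
    ((norm_neg _).le.trans hdiff)
  have h2 : RCLike.re (-((D.card : ℂ) * Q c - ∑ z ∈ Z, Q (x z))) =
      ∑ z ∈ Z, RCLike.re (Q (x z)) - D.card * RCLike.re (Q c) := by
    simp
  rw [h2] at h1
  have h3 : D.card * (-(2 * ε) * ∑ m ∈ s, ‖c m‖ ^ 2) ≤ D.card * RCLike.re (Q c) := by
    linarith
  exact le_of_mul_le_mul_left h3 hDpos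

end Windows

end Gabor

end

/-! ### Matrix estimates uniform in the lattice, and off-diagonal decay. -/

noncomputable section

namespace Gabor

section Matrices

variable {J : Type*} [Fintype J]

/-- The sum of the absolute values of the entries of a matrix. -/
def entrySum (B : Matrix J J ℝ) : ℝ := ∑ i, ∑ j, |B i j|

theorem entrySum_nonneg (B : Matrix J J ℝ) : 0 ≤ entrySum B := by unfold entrySum; positivity

theorem continuous_entrySum : Continuous (entrySum : Matrix J J ℝ → ℝ) := by
  unfold entrySum
  fun_prop

theorem entrySum_smul (c : ℝ) (B : Matrix J J ℝ) : entrySum (c • B) = |c| * entrySum B := by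
  simp [entrySum, abs_mul, Finset.mul_sum]

theorem norm_latPt_le (B : Matrix J J ℝ) {x : J → ℝ} {r : ℝ} (hx : ∀ j, |x j| ≤ r) :
    ‖latPt B x‖ ≤ entrySum B * r := by
  have h1 : ‖latPt B x‖ ≤ ∑ i, |B.mulVec x i| := by
    rw [EuclideanSpace.norm_eq]
    refine Real.sqrt_le_iff.2 ⟨by positivity, ?_⟩
    simp only [latPt, Real.norm_eq_abs]
    exact Finset.sum_sq_le_sq_sum_of_nonneg fun i _ => abs_nonneg _
  refine h1.trans ?_
  rw [entrySum, Finset.sum_mul]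
  refine Finset.sum_le_sum fun i _ => ?_
  rw [Finset.sum_mul]
  refine (Finset.abs_sum_le_sum_abs _ _).trans (Finset.sum_le_sum fun j _ => ?_)
  rw [abs_mul]
  exact mul_le_mul_of_nonneg_left (hx j) (abs_nonneg _)

theorem isFine_of_entrySum_le {B : Matrix J J ℝ} {δ : ℝ} (h : entrySum B ≤ δ) :
    ProjRep.IsFine B δ := by
  intro v hv
  refine (norm_latPt_le B (r := 1) fun j => ?_).trans (by linarith)
  have := hv j (Set.mem_univ j)
  rw [abs_of_nonneg this.1]
  exact this.2.le

/-- A lower bound for `B`, in the form in which it is used below. -/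
def IsExpanding (B : Matrix J J ℝ) (κ : ℝ) : Prop := ∀ x : J → ℝ, ∑ i, |x i| ≤ κ * ‖latPt B x‖

theorem latPt_sub_left (B D : Matrix J J ℝ) (x : J → ℝ) :
    latPt (B - D) x = latPt B x - latPt D x := by simp [latPt, Matrix.sub_mulVec]

variable [DecidableEq J]

theorem exists_eventually_isExpanding {B₀ : Matrix J J ℝ} (hB : B₀.det ≠ 0) :
    ∃ κ, 0 ≤ κ ∧ ∀ᶠ B in 𝓝 B₀, IsExpanding B κ := by
  set κ₀ : ℝ := Fintype.card J * entrySum B₀⁻¹ with hκ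
  have hκ0 : 0 ≤ κ₀ := mul_nonneg (by positivity) (entrySum_nonneg _)
  have h0 : IsExpanding B₀ κ₀ := by
    intro x
    have h1 : ∀ i, |x i| ≤ entrySum B₀⁻¹ * ‖latPt B₀ x‖ := by
      intro i
      have h2 : latPt B₀⁻¹ (latPt B₀ x).ofLp = WithLp.toLp 2 x := by
        simp [latPt, Matrix.mulVec_mulVec, Matrix.nonsing_inv_mul _ (isUnit_iff_ne_zero.2 hB)]
      have h3 := norm_latPt_le B₀⁻¹ (x := (latPt B₀ x).ofLp) (r := ‖latPt B₀ x‖)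
        fun j => PiLp.norm_apply_le (latPt B₀ x) j
      rw [h2] at h3
      exact (PiLp.norm_apply_le (WithLp.toLp 2 x) i).trans h3
    calc _ ≤ ∑ _i : J, entrySum B₀⁻¹ * ‖latPt B₀ x‖ := Finset.sum_le_sum fun i _ => h1 i
      _ = _ := by rw [Finset.sum_const, Finset.card_univ, nsmul_eq_mul, hκ, mul_assoc]
  -- Near `B₀` the perturbation contributes at most half of `∑ |x i|`, which is absorbed at the
  -- price of a factor 2.
  refine ⟨2 * κ₀, by positivity, ?_⟩
  have hc : Filter.Tendsto (fun B => κ₀ * entrySum (B₀ - B)) (𝓝 B₀) (𝓝 0) := by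
    have : Continuous fun B => κ₀ * entrySum (B₀ - B) :=
      continuous_const.mul (continuous_entrySum.comp (continuous_const.sub continuous_id))
    simpa [entrySum] using this.tendsto B₀
  filter_upwards [hc.eventually_le_const (show (0 : ℝ) < 1 / 2 by norm_num)] with B h x
  have hx0 : 0 ≤ ∑ i, |x i| := by positivity
  have h1 := norm_latPt_le (B₀ - B) (x := x) (r := ∑ i, |x i|)
    fun j => Finset.single_le_sum (f := fun i => |x i|) (fun _ _ => abs_nonneg _) (Finset.mem_univ j)
  rw [latPt_sub_left] at h1
  have h2 : ‖latPt B₀ x‖ ≤ ‖latPt B x‖ + ‖latPt B₀ x - latPt B x‖ := by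
    have := norm_add_le (latPt B x) (latPt B₀ x - latPt B x)
    simpa using this
  have h3 := h0 x
  have h4 : κ₀ * ‖latPt B₀ x - latPt B x‖ ≤ 1 / 2 * ∑ i, |x i| := by
    calc _ ≤ κ₀ * (entrySum (B₀ - B) * ∑ i, |x i|) := by gcongr
      _ = (κ₀ * entrySum (B₀ - B)) * ∑ i, |x i| := by ring
      _ ≤ _ := by gcongr
  nlinarith [mul_le_mul_of_nonneg_left h2 hκ0]

end Matrices

namespace ProjRep

section WeightedSums

variable {J H : Type*} [Fintype J] [DecidableEq J] [NormedAddCommGroup H] [InnerProductSpace ℂ H]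
  {π : ProjRep (EuclideanSpace ℝ J) H}

/-- On each cell the weight is dominated by a function of `‖y‖` tending to zero with `1/R`.
Dominated convergence against `M` then yields an `R` that serves all such `B` at once. -/
theorem exists_weighted_sum_le {g : H} {M : EuclideanSpace ℝ J → ℝ≥0∞} (hM : Measurable M)
    (hMint : ∫⁻ z, M z ≠ ∞) (hMg : ∀ z v, ‖v‖ ≤ 2 → ‖π.amb g (z + v)‖ₑ ≤ M z)
    {κ η : ℝ} (hη : 0 < η) : ∃ R : ℕ, 0 < R ∧ ∀ B : Matrix J J ℝ, B.det ≠ 0 →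
      IsFine B 1 → IsExpanding B κ → ENNReal.ofReal |B.det| *
        ∑' j : J → ℤ, ‖π.amb g (latPt B (intPt j))‖ₑ * ENNReal.ofReal (relSize R j) ≤
          ENNReal.ofReal η := by
  -- The summand `Fintype.card J` pays for moving from a point of the cell to its integer corner, at
  -- most one per coordinate.
  set W : ℕ → EuclideanSpace ℝ J → ℝ≥0∞ := fun R y =>
    ENNReal.ofReal (min 1 ((κ * ‖y‖ + Fintype.card J) / R)) with hW
  have hWm : ∀ R, Measurable (W R) := fun R => by
    refine ENNReal.measurable_ofReal.comp ?_
    fun_prop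
  have h1 : Filter.Tendsto (fun R : ℕ => ∫⁻ y, M y * W R y) Filter.atTop
      (𝓝 (∫⁻ _ : EuclideanSpace ℝ J, 0)) := by
    refine tendsto_lintegral_of_dominated_convergence' M
      (fun R => (hM.mul (hWm R)).aemeasurable) (fun R => Filter.Eventually.of_forall fun y => ?_)
      hMint ?_
    · refine mul_le_of_le_one_right (zero_le) ?_
      rw [hW]
      simp
    · filter_upwards [ae_lt_top hM hMint] with y hy
      have h2 : Filter.Tendsto (fun R : ℕ => min 1 ((κ * ‖y‖ + Fintype.card J) / (R : ℝ)))
          Filter.atTop (𝓝 (min 1 0)) :=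
        tendsto_const_nhds.min (tendsto_const_div_atTop_nhds_zero_nat _)
      have h3 := ENNReal.Tendsto.const_mul (a := M y)
        ((ENNReal.continuous_ofReal.tendsto _).comp h2) (Or.inr hy.ne)
      simpa [hW] using h3
  rw [lintegral_zero] at h1
  obtain ⟨R, hR, hR0⟩ := ((h1.eventually_le_const
    (show 0 < ENNReal.ofReal η by simpa using hη)).and (Filter.eventually_gt_atTop 0)).exists
  refine ⟨R, hR0, fun B hB hfine hexp => (det_mul_tsum_le hB (hM.mul (hWm R)) fun j v hv => ?_).trans
    hR⟩
  refine mul_le_mul' ?_ (ENNReal.ofReal_le_ofReal ?_)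
  · have := hMg (latPt B (intPt j + v)) (-latPt B v)
      (by rw [norm_neg]; linarith [hfine v hv])
    rwa [latPt_add, add_neg_cancel_right, ← latPt_add] at this
  · rw [relSize]
    refine min_le_min le_rfl ?_
    gcongr
    refine le_trans ?_ (add_le_add_left (hexp (intPt j + v)) _)
    have : (Fintype.card J : ℝ) = ∑ _i : J, 1 := by simp
    rw [this, ← Finset.sum_add_distrib]
    refine Finset.sum_le_sum fun i _ => ?_
    have h5 := hv i (Set.mem_univ i)
    have h6 := abs_sub (((intPt j + v) i)) (v i)
    simp only [Pi.add_apply, intPt, add_sub_cancel_right] at h6 ⊢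
    rw [abs_of_nonneg h5.1] at h6
    linarith [h5.2]

end WeightedSums

section ShiftedFrameOp

variable {J H : Type*} [Fintype J] [NormedAddCommGroup H] [InnerProductSpace ℂ H]
  {π : ProjRep (EuclideanSpace ℝ J) H}

theorem orbit_nsmul (B : Matrix J J ℝ) (g : H) (q : ℕ) (k : J → ℤ) :
    π.orbit ((q : ℝ) • B) g k = π.orbit B g (q • k) := by
  rw [orbit, orbit, latPt_smul]
  congr 3
  ext i
  simp [intPt]

variable [CompleteSpace H]

/-- The operator `f ↦ ∑ ⟨u i, f⟩ u i - a f`. -/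
def shiftedFrameOp {ι : Type*} (u : ι → H) {C : ℝ} (h : IsBessel u C) (a : ℝ) :
    H →L[ℂ] H := frameOp u h - (a : ℂ) • ContinuousLinearMap.id ℂ H

/-- With `A` the sampled ambiguity function, the entries are dominated by `A * A + aA` at `n - m`,
the sum over the sublattice `qℤ^J` being enlarged to `ℤ^J`. The subadditive weight `T` obeys a
Leibniz rule, `‖T(A * A)‖₁ ≤ 2‖A‖₁‖TA‖₁`. -/
theorem sum_off_diagonal_le {B : Matrix J J ℝ} {g : H} {q : ℕ} (hq : q ≠ 0) {C a : ℝ} (ha : 0 ≤ a)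
    (h : IsBessel (π.orbit ((q : ℝ) • B) g) C) (R : ℕ) (m : J → ℤ) (s : Finset (J → ℤ)) :
    ENNReal.ofReal (∑ n ∈ s, ‖inner ℂ (π.orbit B g m)
      (shiftedFrameOp _ h a (π.orbit B g n))‖ * relSize R (n - m)) ≤
      (2 * (∑' j : J → ℤ, ‖π.amb g (latPt B (intPt j))‖ₑ) + ENNReal.ofReal a) *
      ∑' j : J → ℤ, ‖π.amb g (latPt B (intPt j))‖ₑ * ENNReal.ofReal (relSize R j) := by
  set A : (J → ℤ) → ℝ≥0∞ := fun j => ‖π.amb g (latPt B (intPt j))‖ₑ with hA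
  set T : (J → ℤ) → ℝ≥0∞ := fun j => ENNReal.ofReal (relSize R j) with hT
  have hAe : ∀ j k, ‖inner ℂ (π.orbit B g j) (π.orbit B g k)‖ₑ = A (k - j) := fun j k => by
    rw [← ofReal_norm, norm_inner_orbit, hA]
    simp only
    rw [← ofReal_norm, Real.norm_of_nonneg (π.amb_nonneg _ _)]
  have hTadd : ∀ j k, T (j + k) ≤ T j + T k := fun j k => by
    rw [hT]
    simp only
    rw [← ENNReal.ofReal_add (relSize_nonneg _ _) (relSize_nonneg _ _)]
    exact ENNReal.ofReal_le_ofReal (relSize_add_le _ _ _)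
  have hG : ∀ n, ‖inner ℂ (π.orbit B g m) (shiftedFrameOp _ h a (π.orbit B g n))‖ₑ ≤
      ∑' j, A (j - m) * A (n - j) + ENNReal.ofReal a * A (n - m) := by
    intro n
    have e1 : inner ℂ (π.orbit B g m) (shiftedFrameOp _ h a (π.orbit B g n)) =
        inner ℂ (π.orbit B g m) (frameOp _ h (π.orbit B g n)) -
          a * inner ℂ (π.orbit B g m) (π.orbit B g n) := by
      simp [shiftedFrameOp]
    rw [e1]
    refine (enorm_sub_le).trans (add_le_add ?_ ?_)
    · rw [← (hasSum_inner_frameOp h _ _).tsum_eq]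
      refine (enorm_tsum_le_tsum_enorm).trans ?_
      simp only [orbit_nsmul, enorm_mul, hAe]
      have hinj : Function.Injective fun k : J → ℤ => q • k := fun k k' hk => by
        ext i
        have := congrFun hk i
        simpa [hq] using this
      exact ENNReal.tsum_comp_le_tsum_of_injective hinj fun j => A (j - m) * A (n - j)
    · rw [enorm_mul, hAe, ← ofReal_norm, Complex.norm_real, Real.norm_of_nonneg ha]
  rw [ENNReal.ofReal_sum_of_nonneg fun n _ => mul_nonneg (norm_nonneg _) (relSize_nonneg _ _)]
  calc _ ≤ ∑ n ∈ s, (∑' j, A (j - m) * A (n - j) + ENNReal.ofReal a * A (n - m)) * T (n - m) := by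
        refine Finset.sum_le_sum fun n _ => ?_
        rw [ENNReal.ofReal_mul (norm_nonneg _), ofReal_norm]
        exact mul_le_mul' (hG n) le_rfl
    _ ≤ ∑' n, (∑' j, A (j - m) * A (n - j) + ENNReal.ofReal a * A (n - m)) * T (n - m) :=
        ENNReal.sum_le_tsum s
    _ ≤ ∑' n, ((∑' j, (A (j - m) * T (j - m) * A (n - j) + A (j - m) * (A (n - j) * T (n - j)))) +
          ENNReal.ofReal a * (A (n - m) * T (n - m))) := by
        refine ENNReal.tsum_le_tsum fun n => ?_
        rw [add_mul, ← ENNReal.tsum_mul_right, mul_assoc]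
        refine add_le_add (ENNReal.tsum_le_tsum fun j => ?_) le_rfl
        calc _ ≤ A (j - m) * A (n - j) * (T (j - m) + T (n - j)) := by
              gcongr
              have := hTadd (j - m) (n - j)
              rwa [show j - m + (n - j) = n - m by abel] at this
          _ = _ := by ring
    _ = _ := by
        have hs : ∀ (F : (J → ℤ) → ℝ≥0∞) j, ∑' n, F (n - j) = ∑' n, F n := fun F j =>
          (Equiv.subRight j).tsum_eq F
        rw [ENNReal.tsum_add, ENNReal.tsum_comm, ENNReal.tsum_mul_left,
          hs (fun j => A j * T j)]
        simp only [ENNReal.tsum_add, ENNReal.tsum_mul_left, hs A, hs (fun j => A j * T j)]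
        rw [ENNReal.tsum_mul_right, ENNReal.tsum_mul_right, hs A, hs (fun j => A j * T j)]
        ring

end ShiftedFrameOp

end ProjRep

end Gabor

end

/-! ### Finite parts of the frame operator, and continuity in the lattice. -/

noncomputable section

namespace Gabor

section PartialOp

variable {ι H : Type*} [NormedAddCommGroup H] [InnerProductSpace ℂ H]

/-- The finite part `f ↦ ∑_{i ∈ N} ⟨u i, f⟩ u i - a f` of a shifted frame operator. -/
def partialOp (u : ι → H) (N : Finset ι) (a : ℝ) : H →L[ℂ] H :=
  ∑ i ∈ N, (innerSL ℂ (u i)).smulRight (u i) - (a : ℂ) • ContinuousLinearMap.id ℂ H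

theorem inner_partialOp (u : ι → H) (N : Finset ι) (a : ℝ) (f f' : H) :
    inner ℂ f (partialOp u N a f') =
      ∑ i ∈ N, inner ℂ f (u i) * inner ℂ (u i) f' - a * inner ℂ f f' := by
  simp only [partialOp, sub_apply, sum_apply,
    ContinuousLinearMap.smulRight_apply, innerSL_apply_apply, smul_apply,
    ContinuousLinearMap.id_apply, inner_sub_right, inner_sum, inner_smul_right]
  congr 1
  exact Finset.sum_congr rfl fun i _ => mul_comm _ _

theorem sum_eq_sum_of_forall_notMem {X : Type*} [AddCommMonoid X] {s t : Finset ι} {y : ι → X}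
    (hs : ∀ m, m ∉ s → y m = 0) (ht : ∀ m, m ∉ t → y m = 0) : ∑ m ∈ s, y m = ∑ m ∈ t, y m := by
  classical
  rw [Finset.sum_subset (Finset.subset_union_left (s₂ := t)) fun m _ h => hs m h,
    Finset.sum_subset (Finset.subset_union_right (s₁ := s)) fun m _ h => ht m h]

theorem re_sum_sum_sub_le {E : Finset ι} {G G' : ι → ι → ℂ} {η : ℝ} (hη : 0 ≤ η)
    (h : ∀ m ∈ E, ∀ n ∈ E, ‖G m n - G' m n‖ ≤ η) (x : ι → ℂ) :
    RCLike.re (∑ m ∈ E, ∑ n ∈ E, (starRingEnd ℂ) (x m) * x n * G m n) -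
      η * E.card * ∑ m ∈ E, ‖x m‖ ^ 2 ≤
      RCLike.re (∑ m ∈ E, ∑ n ∈ E, (starRingEnd ℂ) (x m) * x n * G' m n) := by
  have h1 : ‖∑ m ∈ E, ∑ n ∈ E, (starRingEnd ℂ) (x m) * x n * G m n -
      ∑ m ∈ E, ∑ n ∈ E, (starRingEnd ℂ) (x m) * x n * G' m n‖ ≤
      ∑ m ∈ E, ∑ n ∈ E, ‖x m‖ * ‖x n‖ * η := by
    rw [← Finset.sum_sub_distrib]
    refine (norm_sum_le _ _).trans (Finset.sum_le_sum fun m hm => ?_)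
    rw [← Finset.sum_sub_distrib]
    refine (norm_sum_le _ _).trans (Finset.sum_le_sum fun n hn => ?_)
    rw [← mul_sub, norm_mul, norm_mul, RCLike.norm_conj]
    exact mul_le_mul_of_nonneg_left (h m hm n hn) (by positivity)
  have h2 := h1.trans (sum_sum_mul_mul_le (a := fun _ _ => η) (x := fun m => ‖x m‖)
    (C := η * E.card) (fun _ _ => hη) (fun _ _ => rfl) fun _ _ => by simp [mul_comm])
  have h3 := (RCLike.re_le_norm (K := ℂ) _).trans h2
  rw [map_sub] at h3
  linarith

variable [CompleteSpace H] {u : ι → H} {C : ℝ}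

theorem inner_shiftedFrameOp (h : IsBessel u C) (a : ℝ) (f f' : H) :
    inner ℂ f (ProjRep.shiftedFrameOp u h a f') =
      inner ℂ f (frameOp u h f') - a * inner ℂ f f' := by
  simp [ProjRep.shiftedFrameOp]

theorem re_inner_shiftedFrameOp (h : IsBessel u C) (a : ℝ) (f : H) :
    RCLike.re (inner ℂ f (ProjRep.shiftedFrameOp u h a f)) =
      ∑' i, ‖inner ℂ (u i) f‖ ^ 2 - a * ‖f‖ ^ 2 := by
  have e : RCLike.re ((a : ℂ) * inner ℂ f f) = a * ‖f‖ ^ 2 := by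
    rw [← inner_self_eq_norm_sq (𝕜 := ℂ)]
    exact Complex.re_ofReal_mul _ _
  rw [inner_shiftedFrameOp, map_sub, (hasSum_norm_sq_frameOp h f).tsum_eq, e]

/-- The discarded terms are nonnegative, so lower bounds for a finite part pass to the full operator
without uniform control of tails. -/
theorem re_inner_partialOp_le (h : IsBessel u C) (N : Finset ι) (a : ℝ) (f : H) :
    RCLike.re (inner ℂ f (partialOp u N a f)) ≤
      RCLike.re (inner ℂ f (ProjRep.shiftedFrameOp u h a f)) := by
  rw [inner_partialOp, inner_shiftedFrameOp, map_sub, map_sub, map_sum]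
  refine sub_le_sub_right ?_ _
  refine le_trans (le_of_eq (Finset.sum_congr rfl fun i _ => ?_))
    (sum_le_hasSum N (fun _ _ => by positivity) (hasSum_norm_sq_frameOp h f))
  rw [← inner_conj_symm f, RCLike.conj_mul]
  norm_cast

theorem tendsto_inner_partialOp (h : IsBessel u C) (a : ℝ) (f f' : H) :
    Filter.Tendsto (fun N => inner ℂ f (partialOp u N a f')) Filter.atTop
      (𝓝 (inner ℂ f (ProjRep.shiftedFrameOp u h a f'))) := by
  simp only [inner_partialOp, inner_shiftedFrameOp]
  exact (hasSum_inner_frameOp h f f').sub_const _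

theorem inner_shiftedFrameOp_comm (h : IsBessel u C) (a : ℝ) (f f' : H) :
    ‖inner ℂ f (ProjRep.shiftedFrameOp u h a f')‖ =
      ‖inner ℂ f' (ProjRep.shiftedFrameOp u h a f)‖ := by
  rw [inner_shiftedFrameOp, inner_shiftedFrameOp, ← inner_frameOp_comm,
    ← inner_conj_symm, ← inner_conj_symm f, ← RCLike.norm_conj]
  simp

end PartialOp

namespace ProjRep

section Local

variable {J H : Type*} [Fintype J] [NormedAddCommGroup H] [InnerProductSpace ℂ H]
  {π : ProjRep (EuclideanSpace ℝ J) H}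

theorem continuous_orbit (g : H) (j : J → ℤ) : Continuous fun B => π.orbit B g j :=
  (π.continuous_op g).comp (continuous_latPt_left _)

variable [CompleteSpace H]

/-- The lower frame bound is stable under perturbation of the lattice, on the span of finitely
many time-frequency shifts. -/
theorem eventually_local_lower {B₀ : Matrix J J ℝ} {g : H} {q : ℕ} {C a : ℝ}
    (h : IsBessel (π.orbit ((q : ℝ) • B₀) g) C)
    (hlow : ∀ f, a * ‖f‖ ^ 2 ≤ ∑' j, ‖inner ℂ (π.orbit ((q : ℝ) • B₀) g j) f‖ ^ 2)
    (E : Finset (J → ℤ)) {ε : ℝ} (hε : 0 < ε) :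
    ∀ᶠ B in 𝓝 B₀, ∀ (C' : ℝ) (h' : IsBessel (π.orbit ((q : ℝ) • B) g) C') (x : (J → ℤ) → ℂ),
      -ε * ∑ m ∈ E, ‖x m‖ ^ 2 ≤ RCLike.re (inner ℂ (∑ m ∈ E, x m • π.orbit B g m)
        (shiftedFrameOp _ h' a (∑ m ∈ E, x m • π.orbit B g m))) := by
  -- Two replacements, full operator by finite part at `B₀` and then `B₀` by `B`, cost `η * E.card`
  -- each; the `+ 1` covers empty `E`.
  set η : ℝ := ε / (2 * (E.card + 1)) with hηdef
  have hη : 0 < η := by positivity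
  have hηε : η * E.card + η * E.card ≤ ε := by
    rw [hηdef]; field_simp; linarith
  have hN : ∀ᶠ N in Filter.atTop, ∀ m ∈ E, ∀ n ∈ E,
      ‖inner ℂ (π.orbit B₀ g m) (shiftedFrameOp _ h a (π.orbit B₀ g n)) -
        inner ℂ (π.orbit B₀ g m) (partialOp (π.orbit ((q : ℝ) • B₀) g) N a (π.orbit B₀ g n))‖
        ≤ η := by
    rw [Finset.eventually_all]
    intro m _
    rw [Finset.eventually_all]
    intro n _
    have h1 := (tendsto_inner_partialOp h a (π.orbit B₀ g m) (π.orbit B₀ g n)).const_sub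
      (inner ℂ (π.orbit B₀ g m) (shiftedFrameOp _ h a (π.orbit B₀ g n)))
    rw [sub_self] at h1
    have h2 := h1.norm
    rw [norm_zero] at h2
    exact h2.eventually_le_const hη
  obtain ⟨N, hN⟩ := hN.exists
  have hB : ∀ᶠ B in 𝓝 B₀, ∀ m ∈ E, ∀ n ∈ E,
      ‖inner ℂ (π.orbit B₀ g m) (partialOp (π.orbit ((q : ℝ) • B₀) g) N a (π.orbit B₀ g n)) -
        inner ℂ (π.orbit B g m) (partialOp (π.orbit ((q : ℝ) • B) g) N a (π.orbit B g n))‖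
        ≤ η := by
    rw [Finset.eventually_all]
    intro m _
    rw [Finset.eventually_all]
    intro n _
    have hc : Continuous fun B : Matrix J J ℝ => inner ℂ (π.orbit B g m)
        (partialOp (π.orbit ((q : ℝ) • B) g) N a (π.orbit B g n)) := by
      simp only [inner_partialOp, orbit_nsmul]
      refine (continuous_finsetSum _ fun k _ => ?_).sub (continuous_const.mul ?_)
      · exact ((continuous_orbit g m).inner (continuous_orbit g _)).mul
          ((continuous_orbit g _).inner (continuous_orbit g n))
      · exact (continuous_orbit g m).inner (continuous_orbit g n)
    have h1 := (hc.tendsto B₀).const_sub (inner ℂ (π.orbit B₀ g m)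
      (partialOp (π.orbit ((q : ℝ) • B₀) g) N a (π.orbit B₀ g n)))
    rw [sub_self] at h1
    have h2 := h1.norm
    rw [norm_zero] at h2
    exact h2.eventually_le_const hη
  filter_upwards [hB] with B hB C' h' x
  refine le_trans ?_ (re_inner_partialOp_le h' N a _)
  have h0 : 0 ≤ RCLike.re (inner ℂ (∑ m ∈ E, x m • π.orbit B₀ g m)
        (shiftedFrameOp _ h a (∑ m ∈ E, x m • π.orbit B₀ g m))) := by
    rw [re_inner_shiftedFrameOp]
    exact sub_nonneg.2 (hlow _)
  rw [inner_sum_smul_apply] at h0 ⊢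
  have h1 := re_sum_sum_sub_le hη.le hN x
  have h2 := re_sum_sum_sub_le hη.le hB x
  have hx : 0 ≤ ∑ m ∈ E, ‖x m‖ ^ 2 := by positivity
  nlinarith [mul_le_mul_of_nonneg_right hηε hx]

end Local

end ProjRep

end Gabor

end

/-! ### Stability of the lower frame bound. -/

noncomputable section

namespace Gabor

namespace ProjRep

section Stability

variable {J H : Type*} [Fintype J] [NormedAddCommGroup H] [InnerProductSpace ℂ H]
  {π : ProjRep (EuclideanSpace ℝ J) H}

theorem isBessel_orbit_nsmul {B : Matrix J J ℝ} {g : H} {C : ℝ} (h : IsBessel (π.orbit B g) C)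
    {q : ℕ} (hq : q ≠ 0) : IsBessel (π.orbit ((q : ℝ) • B) g) C := by
  have hinj : Function.Injective fun k : J → ℤ => q • k := fun k k' hk => by
    ext i
    have := congrFun hk i
    simpa [hq] using this
  have e : π.orbit ((q : ℝ) • B) g = π.orbit B g ∘ fun k => q • k :=
    funext fun k => orbit_nsmul B g q k
  rw [e]
  exact h.comp hinj

/-- Every lattice is a sublattice of a fine one, from which it inherits a Bessel bound. -/
theorem exists_nsmul_fine (A : Matrix J J ℝ) {δ : ℝ} (hδ : 0 < δ) :
    ∃ (q : ℕ) (B : Matrix J J ℝ), q ≠ 0 ∧ A = (q : ℝ) • B ∧ entrySum B < δ := by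
  obtain ⟨q, hq⟩ := exists_nat_gt (entrySum A / δ)
  have hq0 : (0 : ℝ) < q := (div_nonneg (entrySum_nonneg A) hδ.le).trans_lt hq
  refine ⟨q, (q : ℝ)⁻¹ • A, by exact_mod_cast hq0.ne', by rw [smul_inv_smul₀ hq0.ne'], ?_⟩
  rw [entrySum_smul, abs_of_pos (by positivity), inv_mul_lt_iff₀ hq0]
  rwa [div_lt_iff₀ hδ] at hq

theorem latPt_nsmul_intPt (B : Matrix J J ℝ) (q : ℕ) (k : J → ℤ) :
    latPt B (intPt (q • k)) = latPt ((q : ℝ) • B) (intPt k) := by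
  rw [latPt_smul]
  congr 1
  ext i
  simp [intPt]

variable [DecidableEq J]

theorem tsum_enorm_amb_le {g : H} {M : EuclideanSpace ℝ J → ℝ≥0∞} (hM : Measurable M)
    (hMg : ∀ z v, ‖v‖ ≤ 2 → ‖π.amb g (z + v)‖ₑ ≤ M z) {B : Matrix J J ℝ} (hB : B.det ≠ 0)
    (hfine : IsFine B 1) :
    ENNReal.ofReal |B.det| * ∑' j : J → ℤ, ‖π.amb g (latPt B (intPt j))‖ₑ ≤ ∫⁻ z, M z := by
  refine det_mul_tsum_le hB hM fun j v hv => ?_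
  have := hMg (latPt B (intPt j + v)) (-latPt B v) (by rw [norm_neg]; linarith [hfine v hv])
  rwa [latPt_add, add_neg_cancel_right, ← latPt_add] at this

theorem det_ne_zero_of_nsmul {q : ℕ} {B : Matrix J J ℝ} (h : ((q : ℝ) • B).det ≠ 0) :
    B.det ≠ 0 := by
  rw [Matrix.det_smul] at h
  exact right_ne_zero_of_mul h

variable [CompleteSpace H]

theorem exists_isBessel (hπ : π.Moyal) {g : H} (hg : g ≠ 0) (hint : ∫⁻ z, ‖π.amb g z‖ₑ ≠ ∞)
    {A : Matrix J J ℝ} (hA : A.det ≠ 0) : ∃ C, 0 ≤ C ∧ IsBessel (π.orbit A g) C := by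
  obtain ⟨δ, C, hδ, -, hC, hfine⟩ := exists_fine_frame hπ hg hint
  obtain ⟨q, B, hq, rfl, hB⟩ := exists_nsmul_fine A hδ
  exact ⟨_, div_nonneg hC (abs_nonneg _), isBessel_orbit_nsmul
    (hfine B (det_ne_zero_of_nsmul hA) (isFine_of_entrySum_le hB.le)).1 hq⟩

/-- A local lower bound at the origin gives local lower bounds everywhere, by covariance. -/
theorem local_lower_of_box {B : Matrix J J ℝ} {g : H} {q R : ℕ} (hq : q ≠ 0) {C a ε : ℝ}
    (h : IsBessel (π.orbit ((q : ℝ) • B) g) C)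
    (hloc : ∀ x : (J → ℤ) → ℂ, -ε * ∑ m ∈ box J (R + q), ‖x m‖ ^ 2 ≤
      RCLike.re (inner ℂ (∑ m ∈ box J (R + q), x m • π.orbit B g m)
        (shiftedFrameOp _ h a (∑ m ∈ box J (R + q), x m • π.orbit B g m))))
    (s : Finset (J → ℤ)) (z : J → ℤ) (x : (J → ℤ) → ℂ)
    (hx : ∀ m ∈ s, x m ≠ 0 → m - z ∈ box J R) :
    -ε * ∑ m ∈ s, ‖x m‖ ^ 2 ≤ RCLike.re (inner ℂ (∑ m ∈ s, x m • π.orbit B g m)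
        (shiftedFrameOp _ h a (∑ m ∈ s, x m • π.orbit B g m))) := by
  -- Only shifts by `qℤ^J` preserve the frame sum over `qB`. Rounding `z` down to a multiple of `q`
  -- leaves a remainder in `[0, q)`, hence the box of side `R + q`.
  set k₀ : J → ℤ := fun i => z i / q with hk₀
  set E := box J (R + q) with hE
  set P := π.op (latPt B (intPt (q • k₀))) with hP
  choose c hc hcP using fun j => π.exists_orbit_add B (q • k₀) j
  set y : (J → ℤ) → ℂ := fun m => if m ∈ s then x m else 0 with hy
  have hys : ∀ m, m ∉ s → y m = 0 := fun m hm => by simp [hy, hm]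
  have hyE : ∀ m, m ∉ E.map (Equiv.addLeft (q • k₀)).toEmbedding → y m = 0 := by
    intro m hm
    by_contra hne
    have hms : m ∈ s := by
      by_contra h0
      exact hne (hys m h0)
    have hxm : x m ≠ 0 := by simpa [hy, hms] using hne
    refine hm (Finset.mem_map.2 ⟨m - q • k₀, ?_, by simp⟩)
    have h1 := mem_box.1 (hx m hms hxm)
    refine mem_box.2 fun i => ?_
    have h2 := h1 i
    have h3 : (0 : ℤ) < q := by exact_mod_cast Nat.pos_of_ne_zero hq
    have h4 := Int.emod_nonneg (z i) h3.ne'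
    have h5 := Int.emod_lt_of_pos (z i) h3
    have h6 := Int.mul_ediv_add_emod (z i) q
    have h7 : (q • k₀) i = q * (z i / q) := by simp [hk₀]
    rw [Pi.sub_apply] at h2 ⊢
    rw [h7]
    push_cast
    constructor <;> linarith
  have hsum : ∑ m ∈ s, x m • π.orbit B g m =
      P (∑ j ∈ E, (c j * y (q • k₀ + j)) • π.orbit B g j) := by
    calc _ = ∑ m ∈ s, y m • π.orbit B g m :=
          Finset.sum_congr rfl fun m hm => by simp [hy, hm]
      _ = ∑ m ∈ E.map (Equiv.addLeft (q • k₀)).toEmbedding, y m • π.orbit B g m :=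
          sum_eq_sum_of_forall_notMem (fun m hm => by rw [hys m hm, zero_smul])
            fun m hm => by rw [hyE m hm, zero_smul]
      _ = _ := by
          rw [Finset.sum_map, map_sum]
          refine Finset.sum_congr rfl fun j _ => ?_
          simp only [Equiv.coe_toEmbedding, Equiv.coe_addLeft]
          rw [hcP, map_smul, smul_smul, mul_comm]
  have hnorm : ∑ m ∈ s, ‖x m‖ ^ 2 = ∑ j ∈ E, ‖c j * y (q • k₀ + j)‖ ^ 2 := by
    calc _ = ∑ m ∈ s, ‖y m‖ ^ 2 :=
          Finset.sum_congr rfl fun m hm => by simp [hy, hm]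
      _ = ∑ m ∈ E.map (Equiv.addLeft (q • k₀)).toEmbedding, ‖y m‖ ^ 2 :=
          sum_eq_sum_of_forall_notMem (fun m hm => by rw [hys m hm]; simp)
            fun m hm => by rw [hyE m hm]; simp
      _ = _ := by
          rw [Finset.sum_map]
          refine Finset.sum_congr rfl fun j _ => ?_
          simp [hc]
  rw [hsum, hnorm]
  refine (hloc fun j => c j * y (q • k₀ + j)).trans (le_of_eq ?_)
  set f := ∑ j ∈ E, (c j * y (q • k₀ + j)) • π.orbit B g j
  rw [re_inner_shiftedFrameOp, re_inner_shiftedFrameOp, LinearIsometry.norm_map, hP,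
    latPt_nsmul_intPt, tsum_norm_inner_orbit_op]

/-- Stability of Gabor frames under perturbation of the lattice. -/
theorem eventually_lower_bound (hπ : π.Moyal) {g : H} (hg : g ≠ 0)
    (hint : ∫⁻ z, ‖π.amb g z‖ₑ ≠ ∞) {A : Matrix J J ℝ} (hA : A.det ≠ 0) {a : ℝ} (ha : 0 < a)
    (hlow : ∀ f, a * ‖f‖ ^ 2 ≤ ∑' j, ‖inner ℂ (π.orbit A g j) f‖ ^ 2) :
    ∀ᶠ A' in 𝓝 A, A'.det ≠ 0 ∧
      ∀ f, a / 2 * ‖f‖ ^ 2 ≤ ∑' j, ‖inner ℂ (π.orbit A' g j) f‖ ^ 2 := by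
  obtain ⟨δ, C, hδ, hδ1, hC, hfine⟩ := exists_fine_frame hπ hg hint
  obtain ⟨M, hM, hMint, hMg⟩ := exists_majorant hπ hg hint 2
  obtain ⟨q, B₀, hq, rfl, hB₀⟩ := exists_nsmul_fine A hδ
  have hdet₀ := det_ne_zero_of_nsmul hA
  have hgn : 0 < ‖g‖ := norm_pos_iff.2 hg
  have hq0 : (q : ℝ) ≠ 0 := by exact_mod_cast hq
  obtain ⟨κ, hκ, hexp⟩ := exists_eventually_isExpanding hdet₀
  set d := |B₀.det| with hd
  have hd0 : 0 < d := abs_pos.2 hdet₀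
  -- A common lower frame bound for the fine lattices `B` with `|det B| < 2d`.
  set a₀ := ‖g‖ ^ 2 / 4 / (2 * d) with ha₀
  have ha₀' : 0 < a₀ := by positivity
  -- Localization loses `2ε ∑ |c_m|² ≤ 2ε‖f‖²/a₀`, which is half of `a‖f‖²`.
  set ε := a * a₀ / 4 with hε
  have hε0 : 0 < ε := by positivity
  set I := (∫⁻ z, M z).toReal with hI
  have hI0 : 0 ≤ I := ENNReal.toReal_nonneg
  -- Solves `(2 · (2I/d) + a) · (2η/d) = ε`; the factors `2/d` come from dividing by `|det B| >
  -- d/2`.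
  set η := ε * d / (2 * (4 * I / d + a)) with hη
  have hη0 : 0 < η := by positivity
  obtain ⟨R, hR, hτ⟩ := exists_weighted_sum_le (π := π) (g := g) hM hMint hMg (κ := κ) hη0
  have hev : ∀ᶠ B in 𝓝 B₀, B.det ≠ 0 ∧ ∀ f, a / 2 * ‖f‖ ^ 2 ≤
      ∑' j, ‖inner ℂ (π.orbit ((q : ℝ) • B) g j) f‖ ^ 2 := by
    have hcd : Continuous fun B : Matrix J J ℝ => |B.det| := (continuous_id.matrix_det).abs
    obtain ⟨C₀, hC₀, hbes₀⟩ := exists_isBessel hπ hg hint hA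
    filter_upwards [(continuous_entrySum.tendsto B₀).eventually_lt_const hB₀,
      (hcd.tendsto B₀).eventually_lt_const (show |B₀.det| < 2 * d by linarith),
      (hcd.tendsto B₀).eventually_const_lt (show d / 2 < |B₀.det| by linarith), hexp,
      eventually_local_lower hbes₀ hlow (box J (R + q)) hε0] with B hBe hB2 hB1 hBexp hBloc
    have hBdet : 0 < |B.det| := lt_trans (by positivity) hB1
    have hBdet0 : B.det ≠ 0 := abs_pos.1 hBdet
    have hBfine := isFine_of_entrySum_le hBe.le
    have hBfine1 : IsFine B 1 := fun v hv => (hBfine v hv).trans hδ1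
    obtain ⟨hbes, hblow⟩ := hfine B hBdet0 hBfine
    have hbesq := isBessel_orbit_nsmul hbes hq
    have hdiv : ∀ {S : ℝ≥0∞} {r : ℝ}, ENNReal.ofReal |B.det| * S ≤ ENNReal.ofReal r →
        S ≤ ENNReal.ofReal (2 * r / d) := by
      intro S r hS
      have h1 : ENNReal.ofReal (d / 2) * S ≤ ENNReal.ofReal r :=
        le_trans (by gcongr) hS
      rw [mul_comm, ← ENNReal.le_div_iff_mul_le (by simp [hd0]) (by simp),
        ← ENNReal.ofReal_div_of_pos (by positivity)] at h1
      convert h1 using 2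
      field_simp
    have hα : ∑' j : J → ℤ, ‖π.amb g (latPt B (intPt j))‖ₑ ≤ ENNReal.ofReal (2 * I / d) := by
      refine hdiv ((tsum_enorm_amb_le hM hMg hBdet0 hBfine1).trans ?_)
      rw [hI, ENNReal.ofReal_toReal hMint]
    have hτ' := hdiv (hτ B hBdet0 hBfine1 hBexp)
    have hoff : ∀ s : Finset (J → ℤ), ∀ m ∈ s, ∑ n ∈ s, ‖inner ℂ (π.orbit B g m)
        (shiftedFrameOp _ hbesq a (π.orbit B g n))‖ * relSize R (n - m) ≤ ε := by
      intro s m _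
      rw [← ENNReal.ofReal_le_ofReal_iff hε0.le]
      refine (sum_off_diagonal_le hq ha.le hbesq R m s).trans ?_
      calc _ ≤ (2 * ENNReal.ofReal (2 * I / d) + ENNReal.ofReal a) *
            ENNReal.ofReal (2 * η / d) := by gcongr
        _ = ENNReal.ofReal ((2 * (2 * I / d) + a) * (2 * η / d)) := by
            rw [ENNReal.ofReal_mul (by positivity), ENNReal.ofReal_add (by positivity) ha.le,
              ENNReal.ofReal_mul (p := 2) (by positivity), ENNReal.ofReal_ofNat]
        _ ≤ _ := by
            refine ENNReal.ofReal_le_ofReal (le_of_eq ?_)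
            rw [hη]
            field_simp
            ring
    have hblow' : ∀ f, a₀ * ‖f‖ ^ 2 ≤ ∑' j, ‖inner ℂ (π.orbit B g j) f‖ ^ 2 := fun f => by
      refine le_trans (mul_le_mul_of_nonneg_right ?_ (by positivity)) (hblow f)
      exact div_le_div_of_nonneg_left (by positivity) hBdet hB2.le
    refine ⟨hBdet0, fun f => ?_⟩
    set W := shiftedFrameOp _ hbesq a with hW
    have happrox : ∀ n : ℕ, ∃ f', ‖f' - f‖ < 1 / ((n : ℝ) + 1) ∧
        -(a / 2 * ‖f‖ ^ 2) ≤ RCLike.re (inner ℂ f' (W f')) := by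
      intro n
      obtain ⟨s, c, hsc, hcn⟩ := exists_finset_expansion hbes ha₀' hblow' f
        (show 0 < 1 / ((n : ℝ) + 1) by positivity)
      refine ⟨_, hsc, ?_⟩
      have h1 := le_re_inner_of_local hR (fun _ _ => inner_shiftedFrameOp_comm hbesq a _ _) (hoff s)
        (fun z x hx => local_lower_of_box hq hbesq (hBloc _ hbesq) s z x hx) c
      refine le_trans ?_ h1
      have h2 : 2 * ε * ∑ m ∈ s, ‖c m‖ ^ 2 ≤ 2 * ε * (‖f‖ ^ 2 / a₀) := by gcongr
      have h3 : 2 * ε * (‖f‖ ^ 2 / a₀) = a / 2 * ‖f‖ ^ 2 := by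
        rw [hε]; field_simp; ring
      linarith
    choose F hF hFW using happrox
    have hFlim : Filter.Tendsto F Filter.atTop (𝓝 f) := by
      rw [tendsto_iff_norm_sub_tendsto_zero]
      exact squeeze_zero (fun _ => norm_nonneg _) (fun n => (hF n).le)
        tendsto_one_div_add_atTop_nhds_zero_nat
    have hWc : Continuous fun f => RCLike.re (inner ℂ f (W f)) :=
      RCLike.continuous_re.comp (continuous_id.inner W.continuous)
    have h1 := ge_of_tendsto ((hWc.tendsto f).comp hFlim) (Filter.Eventually.of_forall hFW)
    rw [hW, re_inner_shiftedFrameOp] at h1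
    linarith
  have hcont : Filter.Tendsto (fun A' : Matrix J J ℝ => (q : ℝ)⁻¹ • A') (𝓝 ((q : ℝ) • B₀))
      (𝓝 B₀) := by
    have := (continuous_const_smul ((q : ℝ)⁻¹)).tendsto ((q : ℝ) • B₀)
    rwa [inv_smul_smul₀ hq0] at this
  filter_upwards [hcont.eventually hev] with A' h
  rw [smul_inv_smul₀ hq0] at h
  refine ⟨?_, h.2⟩
  have := h.1
  rw [Matrix.det_smul] at this
  exact right_ne_zero_of_mul this

end Stability

end ProjRep

end Gabor

end

/-! ### Plancherel's theorem, and time-frequency shifts as a representation. -/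

noncomputable section

namespace Gabor

section Plancherel

open scoped FourierTransform SchwartzMap

theorem eLpNorm_two_sq {α : Type*} [MeasurableSpace α] {μ : Measure α} (f : α → ℂ) :
    eLpNorm f 2 μ ^ 2 = ∫⁻ x, ‖f x‖ₑ ^ 2 ∂μ := by
  rw [eLpNorm_eq_lintegral_rpow_enorm_toReal (by norm_num) (by norm_num)]
  simp only [ENNReal.toReal_ofNat, ENNReal.rpow_ofNat, one_div]
  rw [← ENNReal.rpow_natCast, ← ENNReal.rpow_mul]
  simp

/-- Both sides have the same pairing with test functions: the `L²` transform by its agreement with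
the distributional one, the integral by the multiplication formula. -/
theorem fourier_toLp_ae_eq {d : ℕ} {h : Time d → ℂ} (h1 : Integrable h) (h2 : MemLp h 2) :
    (𝓕 (h2.toLp h : L2 d) : L2 d) =ᵐ[volume] 𝓕 h := by
  have hcont : Continuous (𝓕 h) :=
    VectorFourier.fourierIntegral_continuous Real.continuous_fourierChar continuous_inner h1
  refine ae_eq_of_integral_contDiff_smul_eq ((Lp.memLp _).locallyIntegrable (by norm_num))
    hcont.locallyIntegrable fun g g_smooth g_cpt => ?_
  have hg₁ : HasCompactSupport (Complex.ofRealCLM ∘ g) := g_cpt.comp_left rfl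
  have hg₂ : ContDiff ℝ ((⊤ : ℕ∞) : WithTop ℕ∞) (Complex.ofRealCLM ∘ g) := by fun_prop
  set φ : 𝓢(Time d, ℂ) := hg₁.toSchwartzMap hg₂ with hφ
  have e1 : ∀ F : Time d → ℂ, ∫ x, g x • F x = ∫ x, φ x • F x := fun F => by
    refine integral_congr_ae (Filter.Eventually.of_forall fun x => ?_)
    simp [hφ]
  rw [e1, e1]
  have e2 := congrArg (fun T : 𝓢'(Time d, ℂ) => T φ)
    (Lp.fourier_toTemperedDistribution_eq (h2.toLp h))
  simp only [TemperedDistribution.fourier_apply, Lp.toTemperedDistribution_apply] at e2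
  rw [← e2]
  have e3 : ∫ x, 𝓕 φ x • (h2.toLp h : L2 d) x = ∫ x, 𝓕 φ x • h x := by
    refine integral_congr_ae ?_
    filter_upwards [h2.coeFn_toLp] with x hx
    rw [hx]
  rw [e3]
  have e4 := VectorFourier.integral_fourierIntegral_smul_eq_flip (L := innerₗ (Time d))
    Real.continuous_fourierChar continuous_inner h1 (φ.integrable (μ := volume))
  simp only [smul_eq_mul] at e4 ⊢
  calc _ = ∫ x, h x * 𝓕 φ x := by simp only [mul_comm]
    _ = ∫ ξ, 𝓕 h ξ * φ ξ := by
      refine Eq.trans ?_ e4.symm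
      refine integral_congr_ae (Filter.Eventually.of_forall fun x => ?_)
      simp only
      rw [flip_innerₗ]
      rfl
    _ = _ := by simp only [mul_comm]

/-- Plancherel's theorem for the Fourier integral on `L¹ ∩ L²`. -/
theorem lintegral_enorm_fourier_sq {d : ℕ} {h : Time d → ℂ} (h1 : Integrable h)
    (h2 : MemLp h 2) : ∫⁻ ξ, ‖𝓕 h ξ‖ₑ ^ 2 = ∫⁻ t, ‖h t‖ₑ ^ 2 := by
  rw [← eLpNorm_two_sq, ← eLpNorm_two_sq, ← eLpNorm_congr_ae (fourier_toLp_ae_eq h1 h2),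
    ← Lp.enorm_def, ← Lp.enorm_toLp h2, ← ofReal_norm, ← ofReal_norm, Lp.norm_fourier_eq]

end Plancherel

section TFShift

variable {d : ℕ}

theorem coeFn_tfShift (z : Phase d) (f : L2 d) : tfShift z f =ᵐ[volume] tfShiftFun z f :=
  MemLp.coeFn_toLp _

theorem tfShiftFun_congr (z : Phase d) {f h : Time d → ℂ} (hfh : f =ᵐ[volume] h) :
    tfShiftFun z f =ᵐ[volume] tfShiftFun z h := by
  have := (measurePreserving_sub_right (volume : Measure (Time d))
    (timePart z)).quasiMeasurePreserving.ae hfh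
  filter_upwards [this] with t ht
  simp only [tfShiftFun, ht]

theorem enorm_exp_mul_I (r : ℝ) : ‖Complex.exp (2 * Real.pi * Complex.I * r)‖ₑ = 1 := by
  rw [← ofReal_norm, Complex.norm_exp]
  simp

theorem enorm_tfShiftFun (z : Phase d) (f : Time d → ℂ) (t : Time d) :
    ‖tfShiftFun z f t‖ₑ = ‖f (t - timePart z)‖ₑ := by
  rw [tfShiftFun, enorm_mul, enorm_exp_mul_I, one_mul]

theorem enorm_sq_eq (f : L2 d) : ‖f‖ₑ ^ 2 = ∫⁻ t, ‖f t‖ₑ ^ 2 := by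
  rw [Lp.enorm_def, eLpNorm_two_sq]

theorem norm_tfShift (z : Phase d) (f : L2 d) : ‖tfShift z f‖ = ‖f‖ := by
  have h1 : ‖tfShift z f‖ₑ ^ 2 = ‖f‖ₑ ^ 2 := by
    rw [enorm_sq_eq, enorm_sq_eq]
    refine Eq.trans ?_ (lintegral_sub_right_eq_self (fun t => ‖f t‖ₑ ^ 2) (timePart z))
    refine lintegral_congr_ae ?_
    filter_upwards [coeFn_tfShift z f] with t ht
    rw [ht, enorm_tfShiftFun]
  have h3 := congrArg ENNReal.toReal h1
  simp only [ENNReal.toReal_pow, toReal_enorm] at h3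
  exact (pow_left_inj₀ (norm_nonneg _) (norm_nonneg _) two_ne_zero).1 h3

/-- The time-frequency shift as a linear isometry. -/
def tfShiftₗᵢ (z : Phase d) : L2 d →ₗᵢ[ℂ] L2 d where
  toFun := tfShift z
  map_add' f h := by
    refine Lp.ext ?_
    filter_upwards [coeFn_tfShift z (f + h), coeFn_tfShift z f, coeFn_tfShift z h,
      Lp.coeFn_add (tfShift z f) (tfShift z h), tfShiftFun_congr z (Lp.coeFn_add f h)]
      with t h1 h2 h3 h4 h5
    rw [h1, h4, h5, Pi.add_apply, h2, h3]
    simp only [tfShiftFun, Pi.add_apply, mul_add]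
  map_smul' c f := by
    refine Lp.ext ?_
    filter_upwards [coeFn_tfShift z (c • f), coeFn_tfShift z f,
      Lp.coeFn_smul c (tfShift z f), tfShiftFun_congr z (Lp.coeFn_smul c f)]
      with t h1 h2 h3 h4
    rw [RingHom.id_apply, h1, h3, h4, Pi.smul_apply, h2]
    simp only [tfShiftFun, Pi.smul_apply, smul_eq_mul]
    ring
  norm_map' := norm_tfShift z

theorem continuous_timePart : Continuous (timePart : Phase d → Time d) := by
  unfold timePart
  exact (PiLp.continuous_toLp 2 _).comp (by fun_prop)

theorem continuous_freqPart : Continuous (freqPart : Phase d → Time d) := by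
  unfold freqPart
  exact (PiLp.continuous_toLp 2 _).comp (by fun_prop)

theorem timePart_add (z w : Phase d) : timePart (z + w) = timePart z + timePart w := rfl

theorem freqPart_add (z w : Phase d) : freqPart (z + w) = freqPart z + freqPart w := rfl

theorem tfShift_zero (f : L2 d) : tfShift 0 f = f := by
  refine Lp.ext ?_
  filter_upwards [coeFn_tfShift 0 f] with t h1
  have h2 : timePart (0 : Phase d) = 0 := rfl
  have h3 : freqPart (0 : Phase d) = 0 := rfl
  rw [h1, tfShiftFun, h2, h3]
  simp

theorem exists_tfShift_add (z w : Phase d) : ∃ c : ℂ, ‖c‖ = 1 ∧ ∀ f,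
    tfShift (z + w) f = c • tfShift z (tfShift w f) := by
  -- The modulation of `w` is evaluated at `t - timePart z`; this phase compensates.
  refine ⟨Complex.exp (2 * Real.pi * Complex.I * (inner ℝ (freqPart w) (timePart z) : ℝ)),
    by rw [Complex.norm_exp]; simp, fun f => Lp.ext ?_⟩
  filter_upwards [coeFn_tfShift (z + w) f, coeFn_tfShift z (tfShift w f),
    tfShiftFun_congr z (coeFn_tfShift w f),
    Lp.coeFn_smul (Complex.exp (2 * Real.pi * Complex.I *
      (inner ℝ (freqPart w) (timePart z) : ℝ))) (tfShift z (tfShift w f))] with t h1 h2 h3 h4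
  rw [h4, Pi.smul_apply, h2, h3, h1]
  simp only [tfShiftFun, timePart_add, freqPart_add, smul_eq_mul, ← mul_assoc, ← Complex.exp_add]
  rw [← sub_sub]
  congr 2
  rw [inner_add_left, inner_sub_right]
  push_cast
  ring

/-- Split the difference into a modulated difference of translates, controlled by continuity of
translation in `L²`, and a difference of modulations of one fixed translate, controlled by dominated
convergence. -/
theorem continuous_tfShift (f : L2 d) : Continuous fun z : Phase d => tfShift z f := by
  rw [continuous_iff_continuousAt]
  intro z₀
  rw [ContinuousAt, tendsto_iff_edist_tendsto_0]
  let e : Phase d → Time d → ℂ := fun z t =>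
    Complex.exp (2 * Real.pi * Complex.I * (inner ℝ (freqPart z) t : ℝ))
  have hec : ∀ z, Continuous (e z) := fun z => by unfold e; fun_prop
  let T : Phase d → L2 d := fun z => Lp.compMeasurePreserving (fun t => t - timePart z)
    (measurePreserving_sub_right volume (timePart z)) f
  have hT : ∀ z, T z =ᵐ[volume] fun t => f (t - timePart z) := fun z =>
    Lp.coeFn_compMeasurePreserving _ _
  have hTc : Continuous T := by
    let G : C(Phase d × Time d, Time d) := ⟨fun p => p.2 - timePart p.1, by
      have := continuous_timePart (d := d)
      fun_prop⟩
    exact Continuous.compMeasurePreservingLp (continuous_const (y := f)) G.curry.continuous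
      (fun z => measurePreserving_sub_right volume (timePart z)) (by norm_num)
  have hbound : ∀ z, edist (tfShift z f) (tfShift z₀ f) ≤ edist (T z) (T z₀) +
      (∫⁻ t, ‖(e z t - e z₀ t) * T z₀ t‖ₑ ^ 2) ^ (1 / 2 : ℝ) := by
    intro z
    have h1 : (fun t => tfShift z f t - tfShift z₀ f t) =ᵐ[volume]
        (fun t => e z t * (T z t - T z₀ t)) + fun t => (e z t - e z₀ t) * T z₀ t := by
      filter_upwards [coeFn_tfShift z f, coeFn_tfShift z₀ f, hT z, hT z₀] with t a1 a2 a3 a4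
      rw [a1, a2, Pi.add_apply, a3, a4]
      simp only [tfShiftFun, e]
      ring
    have hsq : ∀ F : Time d → ℂ, eLpNorm F 2 volume = (∫⁻ t, ‖F t‖ₑ ^ 2) ^ (1 / 2 : ℝ) := by
      intro F
      rw [← eLpNorm_two_sq, ← ENNReal.rpow_natCast, ← ENNReal.rpow_mul]
      simp
    rw [Lp.edist_def, Lp.edist_def, ← hsq]
    refine (eLpNorm_congr_ae h1).le.trans ((eLpNorm_add_le ?_ ?_ (by norm_num)).trans
      (add_le_add (le_of_eq ?_) le_rfl))
    · exact (hec z).aestronglyMeasurable.mul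
        ((Lp.aestronglyMeasurable _).sub (Lp.aestronglyMeasurable _))
    · exact ((hec z).sub (hec z₀)).aestronglyMeasurable.mul (Lp.aestronglyMeasurable _)
    · rw [hsq, hsq]
      congr 1
      refine lintegral_congr fun t => ?_
      rw [enorm_mul, enorm_exp_mul_I, one_mul]
      rfl
  have hlim2 : Filter.Tendsto (fun z => ∫⁻ t, ‖(e z t - e z₀ t) * T z₀ t‖ₑ ^ 2) (𝓝 z₀)
      (𝓝 (∫⁻ _ : Time d, 0)) := by
    refine tendsto_lintegral_filter_of_dominated_convergence (fun t => 4 * ‖T z₀ t‖ₑ ^ 2)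
      (Filter.Eventually.of_forall fun z => ?_)
      (Filter.Eventually.of_forall fun z => Filter.Eventually.of_forall fun t => ?_) ?_
      (Filter.Eventually.of_forall fun t => ?_)
    · exact ((((hec z).sub (hec z₀)).measurable.mul
        (Lp.stronglyMeasurable (T z₀)).measurable).enorm.pow_const 2)
    · rw [enorm_mul, mul_pow]
      gcongr
      have : ‖e z t - e z₀ t‖ₑ ≤ 2 := by
        refine enorm_sub_le.trans ?_
        simp only [e]
        rw [enorm_exp_mul_I, enorm_exp_mul_I]
        norm_num
      calc _ ≤ (2 : ℝ≥0∞) ^ 2 := by gcongr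
        _ = 4 := by norm_num
    · rw [lintegral_const_mul' _ _ (by norm_num), ← enorm_sq_eq]
      exact ENNReal.mul_ne_top (by norm_num) (by simp)
    · have hc : Continuous fun z => ‖(e z t - e z₀ t) * T z₀ t‖ₑ := by
        have := continuous_freqPart (d := d)
        unfold e
        fun_prop
      have := ((ENNReal.continuous_pow 2).comp hc).tendsto z₀
      simpa [Function.comp_def] using this
  have h0 : Filter.Tendsto (fun z => edist (T z) (T z₀) +
      (∫⁻ t, ‖(e z t - e z₀ t) * T z₀ t‖ₑ ^ 2) ^ (1 / 2 : ℝ)) (𝓝 z₀) (𝓝 (0 + 0)) := by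
    refine (tendsto_iff_edist_tendsto_0.1 (hTc.tendsto z₀)).add ?_
    have := (ENNReal.continuous_rpow_const (y := (1 / 2 : ℝ))).tendsto (∫⁻ _ : Time d, 0)
    have := this.comp hlim2
    simpa [Function.comp_def] using this
  rw [add_zero] at h0
  exact tendsto_of_tendsto_of_tendsto_of_le_of_le tendsto_const_nhds h0 (fun _ => zero_le) hbound

/-- The time-frequency shifts as a projective representation of the time-frequency plane. -/
def tfRep (d : ℕ) : ProjRep (Phase d) (L2 d) where
  op := tfShiftₗᵢ
  op_zero := tfShift_zero
  exists_op_add := exists_tfShift_add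
  continuous_op := continuous_tfShift

theorem tfRep_op (z : Phase d) (f : L2 d) : (tfRep d).op z f = tfShift z f := rfl

theorem inner_tfShift (z : Phase d) (f g : L2 d) : inner ℂ (tfShift z g) f = stft g f z := by
  rw [L2.inner_def, stft]
  refine integral_congr_ae ?_
  filter_upwards [coeFn_tfShift z g] with t ht
  rw [ht, RCLike.inner_apply, tfShiftFun, map_mul, ← Complex.exp_conj]
  simp only [map_mul, Complex.conj_I, Complex.conj_ofReal, map_ofNat]
  rw [show 2 * (Real.pi : ℂ) * -Complex.I * ((inner ℝ (freqPart z) t : ℝ) : ℂ) =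
    -(2 * Real.pi * Complex.I * ((inner ℝ (freqPart z) t : ℝ) : ℂ)) by ring]
  ring

end TFShift

end Gabor

end

/-! ### Moyal's formula, and integrability of the ambiguity function. -/

noncomputable section

namespace Gabor

open scoped FourierTransform

variable {d : ℕ}

theorem measurePreserving_timePart_freqPart :
    MeasurePreserving (fun z : Phase d => (timePart z, freqPart z)) := by
  have h1 := PiLp.volume_preserving_ofLp (Fin d ⊕ Fin d)
  have h2 := volume_measurePreserving_sumPiEquivProdPi (fun _ : Fin d ⊕ Fin d => ℝ)
  have h3 := (PiLp.volume_preserving_toLp (Fin d)).prod (PiLp.volume_preserving_toLp (Fin d))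
  exact h3.comp (h2.comp h1)

theorem lintegral_phase {F : Time d × Time d → ℝ≥0∞} (hF : Measurable F) :
    ∫⁻ z : Phase d, F (timePart z, freqPart z) = ∫⁻ x, ∫⁻ ξ, F (x, ξ) := by
  rw [measurePreserving_timePart_freqPart.lintegral_comp hF, Measure.volume_eq_prod,
    lintegral_prod _ hF.aemeasurable]

/-- The product `t ↦ f(t) conj(g(t - x))`, whose Fourier transform is the short-time Fourier
transform at `x`. -/
def windowed (g f : L2 d) (x t : Time d) : ℂ := f t * (starRingEnd ℂ) (g (t - x))

theorem stft_eq_fourier (g f : L2 d) (z : Phase d) :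
    stft g f z = 𝓕 (windowed g f (timePart z)) (freqPart z) := by
  rw [stft, Real.fourier_eq']
  refine integral_congr_ae (Filter.Eventually.of_forall fun t => ?_)
  simp only [windowed, smul_eq_mul]
  rw [mul_comm, real_inner_comm]
  congr 2
  push_cast
  ring

theorem measurable_windowed (g f : L2 d) :
    Measurable fun p : Time d × Time d => windowed g f p.1 p.2 := by
  have hf := (Lp.stronglyMeasurable f).measurable
  have hg := (Lp.stronglyMeasurable g).measurable
  exact (hf.comp measurable_snd).mul
    (Complex.continuous_conj.measurable.comp (hg.comp (measurable_snd.sub measurable_fst)))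

theorem integrable_windowed (g f : L2 d) (x : Time d) : Integrable (windowed g f x) := by
  have h1 : MemLp (fun t => g (t - x)) 2 (volume : Measure (Time d)) :=
    (Lp.memLp g).comp_measurePreserving (measurePreserving_sub_right volume x)
  exact (Lp.memLp f).integrable_mul h1.star

theorem lintegral_lintegral_windowed (g f : L2 d) :
    ∫⁻ x, ∫⁻ t, ‖windowed g f x t‖ₑ ^ 2 = ‖f‖ₑ ^ 2 * ‖g‖ₑ ^ 2 := by
  rw [lintegral_lintegral_swap ((measurable_windowed g f).enorm.pow_const 2).aemeasurable]
  have h1 : ∀ t, ∫⁻ x, ‖windowed g f x t‖ₑ ^ 2 = ‖f t‖ₑ ^ 2 * ‖g‖ₑ ^ 2 := fun t => by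
    simp only [windowed, enorm_mul, mul_pow, RCLike.enorm_conj]
    rw [lintegral_const_mul' _ _ (by simp), enorm_sq_eq g,
      lintegral_sub_left_eq_self (fun s => ‖g s‖ₑ ^ 2) t]
  simp only [h1]
  rw [lintegral_mul_const' _ _ (by simp), ← enorm_sq_eq]

/-- A product of two `L²` functions need not be in `L²`. Tonelli gives this for almost every `x`,
which is enough for Plancherel under the integral over `x`. -/
theorem ae_memLp_windowed (g f : L2 d) : ∀ᵐ x, MemLp (windowed g f x) 2 := by
  have hm := (measurable_windowed g f).enorm.pow_const 2
  have h1 : ∀ᵐ x, ∫⁻ t, ‖windowed g f x t‖ₑ ^ 2 < ∞ := by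
    refine ae_lt_top hm.lintegral_prod_right' ?_
    rw [lintegral_lintegral_windowed]
    exact ENNReal.mul_ne_top (by simp) (by simp)
  filter_upwards [h1] with x hx
  refine ⟨(integrable_windowed g f x).1, ?_⟩
  rw [← eLpNorm_two_sq] at hx
  exact lt_top_iff_ne_top.2 fun h => by simp [h] at hx

theorem measurable_fourier_windowed (g f : L2 d) :
    Measurable fun p : Time d × Time d => 𝓕 (windowed g f p.1) p.2 := by
  simp only [Real.fourier_eq', smul_eq_mul]
  refine StronglyMeasurable.measurable ?_
  refine StronglyMeasurable.integral_prod_right' (f := fun q : (Time d × Time d) × Time d =>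
    Complex.exp (↑(-2 * Real.pi * inner ℝ q.2 q.1.2) * Complex.I) * windowed g f q.1.1 q.2) ?_
  refine Measurable.stronglyMeasurable ?_
  refine Measurable.mul ?_ ((measurable_windowed g f).comp
    ((measurable_fst.comp measurable_fst).prodMk measurable_snd))
  exact Continuous.measurable (by fun_prop)

/-- Moyal's formula (the orthogonality relations) for the short-time Fourier transform. -/
theorem moyal_tfRep : (tfRep d).Moyal := by
  intro f g
  simp only [tfRep_op, inner_tfShift, stft_eq_fourier]
  rw [lintegral_phase ((measurable_fourier_windowed g f).enorm.pow_const 2),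
    ← lintegral_lintegral_windowed]
  refine lintegral_congr_ae ?_
  filter_upwards [ae_memLp_windowed g f] with x hx
  exact lintegral_enorm_fourier_sq (integrable_windowed g f x) hx

/-- As `s` exceeds the dimension `2d` of phase space, the polynomial bound is integrable, and both
hypotheses reduce to `M¹`. -/
theorem lintegral_amb_ne_top {g : L2 d}
    (hg : (∃ s : ℝ, 2 * (d : ℝ) < s ∧ MemMInfty s g) ∨ MemMOne g) :
    ∫⁻ z, ‖(tfRep d).amb g z‖ₑ ≠ ∞ := by
  have hint : Integrable fun z => inner ℂ (tfShift z g) g := by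
    rcases hg with ⟨s, hs, C, hC⟩ | hg
    · have h1 : Integrable fun z : Phase d => C * (1 + ‖z‖) ^ (-s) := by
        refine (integrable_one_add_norm ?_).const_mul C
        simpa [two_mul] using hs
      refine h1.mono' (Continuous.aestronglyMeasurable ?_) (Filter.Eventually.of_forall fun z => ?_)
      · exact (continuous_tfShift g).inner continuous_const
      · rw [inner_tfShift]
        exact hC z
    · exact hg
  exact hint.norm.2.ne

end Gabor

end

/-! ### Passage to lattices and rectangular sets, and the main theorem. -/

noncomputable section

namespace Gabor

variable {d : ℕ}

theorem isFrame_comp_equiv {ι κ H : Type*} [NormedAddCommGroup H] [InnerProductSpace ℂ H]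
    {v : ι → H} (e : κ ≃ ι) : IsFrame (v ∘ e) ↔ IsFrame v := by
  unfold IsFrame
  refine exists_congr fun A => exists_congr fun B => and_congr_right fun _ =>
    and_congr_right fun _ => forall_congr' fun f => ?_
  refine and_congr (e.summable_iff (f := fun i => ‖inner ℂ (v i) f‖ ^ 2)) ?_
  have h := e.tsum_eq fun i => ‖inner ℂ (v i) f‖ ^ 2
  simp only [Function.comp_apply, h]

theorem isFrame_iff {ι H : Type*} [NormedAddCommGroup H] [InnerProductSpace ℂ H] {v : ι → H} :
    IsFrame v ↔ (∃ C, IsBessel v C) ∧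
      ∃ a, 0 < a ∧ ∀ f, a * ‖f‖ ^ 2 ≤ ∑' i, ‖inner ℂ (v i) f‖ ^ 2 := by
  constructor
  · rintro ⟨A, B, hA, -, h⟩
    exact ⟨⟨B, fun f s => ((h f).1.sum_le_tsum s fun _ _ => by positivity).trans (h f).2.2⟩,
      A, hA, fun f => (h f).2.1⟩
  · rintro ⟨⟨C, hC⟩, a, ha, h⟩
    have hC' : IsBessel v (max C 1) := hC.mono (le_max_left _ _)
    exact ⟨a, max C 1, ha, by positivity, fun f => ⟨hC'.summable f, h f, hC'.tsum_le f⟩⟩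

theorem latPt_intPt_injective {A : Matrix (Fin d ⊕ Fin d) (Fin d ⊕ Fin d) ℝ} (hA : A.det ≠ 0) :
    Function.Injective fun k : Fin d ⊕ Fin d → ℤ => latPt A (intPt k) := by
  intro k l hkl
  have h1 : A.mulVec (intPt k) = A.mulVec (intPt l) := WithLp.toLp_injective 2 hkl
  have h2 := Matrix.mulVec_injective_of_isUnit
    ((Matrix.isUnit_iff_isUnit_det A).2 (isUnit_iff_ne_zero.2 hA)) h1
  ext i
  exact Int.cast_injective (α := ℝ) (congrFun h2 i)

theorem isGaborFrame_latticeSet {A : Matrix (Fin d ⊕ Fin d) (Fin d ⊕ Fin d) ℝ} (hA : A.det ≠ 0) (g : L2 d) :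
    IsGaborFrame g (latticeSet A) ↔ IsFrame ((tfRep d).orbit A g) :=
  (isFrame_comp_equiv (Equiv.ofInjective _ (latPt_intPt_injective hA))).symm

section Frames

variable {g : L2 d}

theorem eventually_isGaborFrame (hg0 : g ≠ 0) (hint : ∫⁻ z, ‖(tfRep d).amb g z‖ₑ ≠ ∞) {A : Matrix (Fin d ⊕ Fin d) (Fin d ⊕ Fin d) ℝ}
    (hA : A.det ≠ 0) (h : IsGaborFrame g (latticeSet A)) :
    ∀ᶠ A' in 𝓝 A, A'.det ≠ 0 ∧ IsGaborFrame g (latticeSet A') := by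
  obtain ⟨-, a, ha, hlow⟩ := isFrame_iff.1 ((isGaborFrame_latticeSet hA g).1 h)
  filter_upwards [ProjRep.eventually_lower_bound moyal_tfRep hg0 hint hA ha hlow]
    with A' ⟨hA', hlow'⟩
  obtain ⟨C, -, hC⟩ := ProjRep.exists_isBessel moyal_tfRep hg0 hint hA'
  exact ⟨hA', (isGaborFrame_latticeSet hA' g).2
    (isFrame_iff.2 ⟨⟨C, hC⟩, a / 2, half_pos ha, hlow'⟩)⟩

theorem abs_det_le_one_of_isGaborFrame (hg0 : g ≠ 0) {A : Matrix (Fin d ⊕ Fin d) (Fin d ⊕ Fin d) ℝ}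
    (hA : A.det ≠ 0) (h : IsGaborFrame g (latticeSet A)) : |A.det| ≤ 1 := by
  obtain ⟨⟨C, hC⟩, a, ha, hlow⟩ := isFrame_iff.1 ((isGaborFrame_latticeSet hA g).1 h)
  exact ProjRep.abs_det_le_one moyal_tfRep hg0 hA hC ha hlow

/-- By stability `cA` still gives a frame for some `c > 1`, so `c^{2d}|det A| ≤ 1`; this is strict
for `|det A|` because `2d > 0`. -/
theorem abs_det_lt_one_of_isGaborFrame (hd : 1 ≤ d) (hg0 : g ≠ 0)
    (hint : ∫⁻ z, ‖(tfRep d).amb g z‖ₑ ≠ ∞) {A : Matrix (Fin d ⊕ Fin d) (Fin d ⊕ Fin d) ℝ}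
    (hA : A.det ≠ 0) (h : IsGaborFrame g (latticeSet A)) : |A.det| < 1 := by
  have hc : Filter.Tendsto (fun c : ℝ => c • A) (𝓝[>] 1) (𝓝 A) := by
    have : Filter.Tendsto (fun c : ℝ => c • A) (𝓝 1) (𝓝 ((1 : ℝ) • A)) :=
      Continuous.tendsto (by fun_prop) 1
    rw [one_smul] at this
    exact this.mono_left nhdsWithin_le_nhds
  obtain ⟨c, ⟨hdet, hfr⟩, hc1⟩ := ((hc.eventually (eventually_isGaborFrame hg0 hint hA h)).and
    self_mem_nhdsWithin).exists
  have h1 := abs_det_le_one_of_isGaborFrame hg0 hdet hfr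
  rw [Matrix.det_smul, abs_mul] at h1
  have h2 : 1 < |c ^ Fintype.card (Fin d ⊕ Fin d)| :=
    (one_lt_pow₀ hc1 (by simp; omega)).trans_le (le_abs_self _)
  have h3 : 0 < |A.det| := abs_pos.2 hA
  nlinarith

theorem exists_isGaborFrame_of_entrySum_le (hg0 : g ≠ 0)
    (hint : ∫⁻ z, ‖(tfRep d).amb g z‖ₑ ≠ ∞) :
    ∃ δ : ℝ, 0 < δ ∧ ∀ A : Matrix (Fin d ⊕ Fin d) (Fin d ⊕ Fin d) ℝ, A.det ≠ 0 → entrySum A ≤ δ →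
      IsGaborFrame g (latticeSet A) := by
  obtain ⟨δ, C, hδ, -, -, hfine⟩ := ProjRep.exists_fine_frame moyal_tfRep hg0 hint
  refine ⟨δ, hδ, fun A hA hle => (isGaborFrame_latticeSet hA g).2 (isFrame_iff.2 ?_)⟩
  obtain ⟨h1, h2⟩ := hfine A hA (isFine_of_entrySum_le hle)
  have := norm_pos_iff.2 hg0
  have := abs_pos.2 hA
  exact ⟨⟨_, h1⟩, _, by positivity, h2⟩

end Frames

theorem det_ne_zero_of_GL (A : GL (Fin d ⊕ Fin d) ℝ) : (A : Matrix (Fin d ⊕ Fin d) (Fin d ⊕ Fin d) ℝ).det ≠ 0 :=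
  ((Matrix.isUnit_iff_isUnit_det _).1 A.isUnit).ne_zero

/-- The matrix generating `α ℤ^d × β ℤ^d`. -/
def rectMatrix (d : ℕ) (p : ℝ × ℝ) : Matrix (Fin d ⊕ Fin d) (Fin d ⊕ Fin d) ℝ :=
  Matrix.diagonal (Sum.elim (fun _ => p.1) fun _ => p.2)

theorem continuous_rectMatrix : Continuous (rectMatrix d) := by
  refine Continuous.matrix_diagonal (continuous_pi fun i => ?_)
  cases i
  · exact continuous_fst
  · exact continuous_snd

theorem det_rectMatrix (p : ℝ × ℝ) : (rectMatrix d p).det = (p.1 * p.2) ^ d := by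
  simp [rectMatrix, Matrix.det_diagonal, Fintype.prod_sum_type, mul_pow]

theorem latticeSet_rectMatrix (p : ℝ × ℝ) : latticeSet (rectMatrix d p) = rectSet d p.1 p.2 := by
  ext z
  constructor
  · rintro ⟨k, rfl⟩
    exact ⟨fun i => ⟨k (Sum.inl i), by simp [rectMatrix, Matrix.mulVec_diagonal]⟩,
      fun i => ⟨k (Sum.inr i), by simp [rectMatrix, Matrix.mulVec_diagonal]⟩⟩
  · rintro ⟨h1, h2⟩
    choose k hk using h1
    choose l hl using h2
    refine ⟨Sum.elim k l, ?_⟩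
    ext i
    cases i <;> simp [rectMatrix, Matrix.mulVec_diagonal, hk, hl]

theorem mem_reducedFrameSet {g : L2 d} {p : ℝ × ℝ} : p ∈ reducedFrameSet g ↔
    0 < p.1 ∧ 0 < p.2 ∧ IsGaborFrame g (latticeSet (rectMatrix d p)) := by
  rw [latticeSet_rectMatrix]
  rfl

theorem det_rectMatrix_ne_zero {p : ℝ × ℝ} (h1 : 0 < p.1) (h2 : 0 < p.2) :
    (rectMatrix d p).det ≠ 0 := by
  rw [det_rectMatrix]
  positivity

theorem isOpen_fullFrameSet {g : L2 d} (hg0 : g ≠ 0)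
    (hint : ∫⁻ z, ‖(tfRep d).amb g z‖ₑ ≠ ∞) : IsOpen (fullFrameSet g) := by
  rw [isOpen_coinduced, isOpen_iff_eventually]
  intro A hA
  exact (Units.continuous_val.tendsto A).eventually
    ((eventually_isGaborFrame hg0 hint (det_ne_zero_of_GL A) hA).mono fun _ h => h.2)

theorem isOpen_reducedFrameSet {g : L2 d} (hg0 : g ≠ 0)
    (hint : ∫⁻ z, ‖(tfRep d).amb g z‖ₑ ≠ ∞) : IsOpen (reducedFrameSet g) := by
  rw [isOpen_iff_eventually]
  intro p hp
  obtain ⟨h1, h2, h⟩ := mem_reducedFrameSet.1 hp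
  filter_upwards [continuous_fst.continuousAt.eventually (lt_mem_nhds h1),
    continuous_snd.continuousAt.eventually (lt_mem_nhds h2),
    (continuous_rectMatrix.tendsto p).eventually
      (eventually_isGaborFrame hg0 hint (det_rectMatrix_ne_zero h1 h2) h)] with q h3 h4 h5
  exact mem_reducedFrameSet.2 ⟨h3, h4, h5.2⟩

theorem fullFrameSet_subset (hd : 1 ≤ d) {g : L2 d} (hg0 : g ≠ 0)
    (hint : ∫⁻ z, ‖(tfRep d).amb g z‖ₑ ≠ ∞) : fullFrameSet g ⊆ {L : Lattice d | L.vol < 1} := by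
  rintro ⟨S, A, rfl⟩ hA
  exact (Lattice.vol_ofGL A).trans_lt
    (abs_det_lt_one_of_isGaborFrame hd hg0 hint (det_ne_zero_of_GL A) hA)

theorem reducedFrameSet_subset (hd : 1 ≤ d) {g : L2 d} (hg0 : g ≠ 0)
    (hint : ∫⁻ z, ‖(tfRep d).amb g z‖ₑ ≠ ∞) :
    reducedFrameSet g ⊆ {p : ℝ × ℝ | 0 < p.1 ∧ 0 < p.2 ∧ p.1 * p.2 < 1} := by
  intro p hp
  obtain ⟨h1, h2, h⟩ := mem_reducedFrameSet.1 hp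
  have h3 := (le_abs_self _).trans_lt
    (abs_det_lt_one_of_isGaborFrame hd hg0 hint (det_rectMatrix_ne_zero h1 h2) h)
  rw [det_rectMatrix] at h3
  refine ⟨h1, h2, ?_⟩
  by_contra! h4
  exact h3.not_ge (one_le_pow₀ h4)

end Gabor

theorem mainTheorem8 (d : ℕ) (hd : 1 ≤ d) (g : Gabor.L2 d) (hg0 : g ≠ 0)
    (hg : (∃ s : ℝ, 2 * (d : ℝ) < s ∧ Gabor.MemMInfty s g) ∨ Gabor.MemMOne g) :
    (IsOpen (Gabor.fullFrameSet g) ∧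
      Gabor.fullFrameSet g ⊆ {L : Gabor.Lattice d | L.vol < 1} ∧
      ∃ V ∈ 𝓝 (0 : Matrix (Fin d ⊕ Fin d) (Fin d ⊕ Fin d) ℝ),
        ∀ A : GL (Fin d ⊕ Fin d) ℝ, (A : Matrix (Fin d ⊕ Fin d) (Fin d ⊕ Fin d) ℝ) ∈ V →
          Gabor.Lattice.ofGL A ∈ Gabor.fullFrameSet g) ∧
    (IsOpen (Gabor.reducedFrameSet g) ∧
      Gabor.reducedFrameSet g ⊆ {p : ℝ × ℝ | 0 < p.1 ∧ 0 < p.2 ∧ p.1 * p.2 < 1} ∧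
      ∃ U ∈ 𝓝 ((0 : ℝ), (0 : ℝ)),
        U ∩ {p : ℝ × ℝ | 0 < p.1 ∧ 0 < p.2} ⊆ Gabor.reducedFrameSet g) := by
  have hint := Gabor.lintegral_amb_ne_top hg
  obtain ⟨δ, hδ, hfine⟩ := Gabor.exists_isGaborFrame_of_entrySum_le hg0 hint
  have hc := Gabor.continuous_entrySum (J := Fin d ⊕ Fin d)
  refine ⟨⟨Gabor.isOpen_fullFrameSet hg0 hint, Gabor.fullFrameSet_subset hd hg0 hint,
    {A | Gabor.entrySum A < δ}, (isOpen_lt hc continuous_const).mem_nhds ?_, fun A hA =>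
      hfine A (Gabor.det_ne_zero_of_GL A) (le_of_lt hA)⟩,
    Gabor.isOpen_reducedFrameSet hg0 hint, Gabor.reducedFrameSet_subset hd hg0 hint,
    {p | Gabor.entrySum (Gabor.rectMatrix d p) < δ},
    (isOpen_lt (hc.comp Gabor.continuous_rectMatrix) continuous_const).mem_nhds ?_, ?_⟩
  · simpa [Gabor.entrySum] using hδ
  · simpa [Gabor.entrySum, Gabor.rectMatrix, Matrix.diagonal_apply] using hδ
  · rintro p ⟨hp, h1, h2⟩
    exact Gabor.mem_reducedFrameSet.2
      ⟨h1, h2, hfine _ (Gabor.det_rectMatrix_ne_zero h1 h2) (le_of_lt hp)⟩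

end
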